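/- Let $N\ge 1$, let $X_1,X_2,\dots$ be random real $N\times N$ matrices, put $\Pi_n=X_n X_{n-1}\cdots X_1$, let $v\in\mathbb{R}^N$ be a fixed unit vector, and let $\|\cdot\|$ be the Euclidean norm. Let $s^{(i)}_1,\dots,s^{(i)}_N$ be the eigenvalues of $X_i^{T}X_i$ (the squared singular values of $X_i$) and $\overline{s}^{(i)}=\frac1N\sum_{k=1}^N s^{(i)}_k=\frac1N\operatorname{tr}(X_i^{T}X_i)$. A random matrix $X$ is called rotationally invariant if for every $k\ge 1$, all vectors $v_1,w_1,\dots,v_k,w_k$ and every orthogonal matrix $U$, the random vectors $(\langle w_j,Xv_j\rangle)_{j=1}^k$ and $(\langle Uw_j,XUv_j\rangle)_{j=1}^k$ have the same joint distribution. (i) There is $t_0>0$ such that for every $t\in(0,t_0)$ there is $N_1=N_1(t)$ with the following property. If $N\ge N_1$, $\sigma>0$, and $X_1,X_2,\dots$ are independent, each with independent $\mathcal{N}(0,\sigma^2/N)$ entries, then for every unit vector $v\in\mathbb{R}^N$ and all $n\ge1$, $$\Pr\Bigl\{\Bigl|\tfrac1n\log\|\Pi_n v\|-\log\sigma\Bigr|>t\Bigr\}\le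 2\exp\Bigl(-\tfrac18 Nnt^2\Bigr).$$ (ii) Let $b>0$. For every $t\in(0,1/4)$ there is $N_1=N_1(t,b)$ with the following property. If $N\ge N_1$ and $X_1,X_2,\dots$ are independent, identically distributed, rotationally invariant, almost surely nonzero, and satisfy $\max_k s^{(i)}_k\le b\,\overline{s}^{(i)}$ almost surely, then for every unit vector $v\in\mathbb{R}^N$ and all $n\ge1$, $$\Pr\Bigl\{\Bigl|\tfrac1n\log\|\Pi_n v\|^2-\tfrac1n\sum_{i=1}^n\log\overline{s}^{(i)}\Bigr|>t\Bigr\}\le 2\exp\Bigl(-\tfrac1{32b^2}Nnt^2\Bigr).$$ -/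

import Mathlib

open MeasureTheory ProbabilityTheory Matrix

noncomputable section

namespace RandomProduct

/-- Matrices carry the product σ-algebra of their entries. -/
instance matrixMeasurableSpace {N : ℕ} : MeasurableSpace (Matrix (Fin N) (Fin N) ℝ) :=
  inferInstanceAs (MeasurableSpace (Fin N → Fin N → ℝ))

/-- The squared singular values of a real square matrix `A`: the eigenvalues of `AᴴA`,
listed with multiplicity (for a real matrix `Aᴴ` is the transpose). -/
def sqSing {N : ℕ} (A : Matrix (Fin N) (Fin N) ℝ) (k : Fin N) : ℝ :=
  (Matrix.isHermitian_conjTranspose_mul_self A).eigenvalues k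

/-- The mean `N⁻¹ ∑ₖ sₖ` of the squared singular values. -/
def sbar {N : ℕ} (A : Matrix (Fin N) (Fin N) ℝ) : ℝ :=
  (1 / (N : ℝ)) * ∑ k, sqSing A k

/-- The mean of the squared singular values is `N⁻¹ tr (AᵀA)`. -/
theorem sbar_eq_trace {N : ℕ} (A : Matrix (Fin N) (Fin N) ℝ) :
    sbar A = (1 / (N : ℝ)) * (Aᵀ * A).trace := by
  have h := (Matrix.isHermitian_conjTranspose_mul_self A).trace_eq_sum_eigenvalues
  have h2 : (Aᵀ * A).trace = ∑ k, sqSing A k := by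
    simpa [sqSing, Matrix.conjTranspose_eq_transpose_of_trivial] using h
  rw [sbar, h2]

/-- The Euclidean norm of `A v`. -/
def normApply {N : ℕ} (A : Matrix (Fin N) (Fin N) ℝ) (v : EuclideanSpace ℝ (Fin N)) : ℝ :=
  ‖WithLp.toLp 2 (A *ᵥ v.ofLp)‖

/-- The ordered product of the first `n` terms of a sequence of matrices, later ones on the left.
With `Y i` standing for the matrix number `i + 1`, this is `Π_n = X_n ⋯ X_1`. -/
def matProd {N : ℕ} (Y : ℕ → Matrix (Fin N) (Fin N) ℝ) : ℕ → Matrix (Fin N) (Fin N) ℝ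
  | 0 => 1
  | n + 1 => Y n * matProd Y n

/-- Rotational invariance of a random matrix: for all finite collections of vectors `vᵢ`, `wᵢ` and
every orthogonal `U`, the random vectors `(⟨wᵢ, X vᵢ⟩)ᵢ` and `(⟨U wᵢ, X U vᵢ⟩)ᵢ` have the
same joint distribution. -/
def RotInvariant {N : ℕ} {Ω : Type*} [MeasurableSpace Ω] (μ : Measure Ω)
    (X : Ω → Matrix (Fin N) (Fin N) ℝ) : Prop :=
  ∀ k : ℕ, 1 ≤ k → ∀ v w : Fin k → (Fin N → ℝ), ∀ U ∈ Matrix.orthogonalGroup (Fin N) ℝ,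
    IdentDistrib (fun ω (i : Fin k) => w i ⬝ᵥ (X ω *ᵥ v i))
      (fun ω (i : Fin k) => (U *ᵥ w i) ⬝ᵥ (X ω *ᵥ (U *ᵥ v i))) μ μ

/-- A sequence of independent random `N × N` matrices, each with independent
`𝒩(0, σ²/N)` entries. -/
structure GaussianSeq {N : ℕ} {Ω : Type*} [MeasurableSpace Ω] (μ : Measure Ω) (σ : ℝ)
    (X : ℕ → Ω → Matrix (Fin N) (Fin N) ℝ) : Prop where
  measurable : ∀ i, Measurable (X i)
  indep : iIndepFun X μ
  indep_entries : ∀ i, iIndepFun (fun (p : Fin N × Fin N) ω => X i ω p.1 p.2) μ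
  law : ∀ i j k, μ.map (fun ω => X i ω j k) = gaussianReal 0 (σ ^ 2 / (N : ℝ)).toNNReal

/-- A sequence of i.i.d. rotationally invariant random `N × N` matrices with
`max_k s_k ≤ b s̄` almost surely, and almost surely nonzero (so that `log s̄` is defined). -/
structure BoundedRotInvSeq {N : ℕ} {Ω : Type*} [MeasurableSpace Ω] (μ : Measure Ω) (b : ℝ)
    (X : ℕ → Ω → Matrix (Fin N) (Fin N) ℝ) : Prop where
  measurable : ∀ i, Measurable (X i)
  indep : iIndepFun X μ
  identDistrib : ∀ i, IdentDistrib (X i) (X 0) μ μ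
  rotInvariant : ∀ i, RotInvariant μ (X i)
  bounded : ∀ i, ∀ᵐ ω ∂μ, ∀ k, sqSing (X i ω) k ≤ b * sbar (X i ω)
  ne_zero : ∀ i, ∀ᵐ ω ∂μ, X i ω ≠ 0

end RandomProduct

end

/-!
The proof is a Chernoff bound with moments of order `±k`, where `k` is of order `N t / b`.

Put `D(X) = σ²` in the Gaussian case and `D(X) = s̄` in the rotationally invariant case. Suppose that
`W = ‖X u‖² / D(X)` satisfies `E W ^ (±k) ≤ C` for every unit vector `u`. Since the factors are
independent, integrating them out one at a time, the last one first, gives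
`E (‖Πₙ v‖² / ∏ D(Xᵢ)) ^ (±k) ≤ Cⁿ` (`lintegral_matProd_rpow_le`), and Markov's inequality bounds
both tails of `log ‖Πₙ v‖² - ∑ log D(Xᵢ)` (`measureReal_log_normApply_matProd_le`). What remains is
to prove the moment bounds with `C = exp (2 b k (k + 1) / N)` for `4 b k ≤ N`, and to choose `k`.

In the Gaussian case (`b = 1`) `W` has the law of `‖g‖² / N` for a standard Gaussian vector `g`. In
the rotationally invariant case let `g` be independent of `X`. Given `g`, the variable
`‖X g‖² / (N s̄)` has the law of `(‖g‖² / N) W`. Given `X`, it has the law of the quadratic form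
`q = N⁻¹ ∑ aₖ gₖ²` with weights `aₖ = sₖ / s̄ ∈ [0, b]` of sum `N`
(`RotInvariant.lintegral_gaussian_average`). Since `‖g‖² / N` has mean one, Jensen's inequality
removes this factor, so that exponential and negative moments of `W` are at most those of `q`; no
Haar measure and no law on the sphere is needed.

The moments of `q` are explicit. For the positive ones `W ^ k ≤ exp (k (W - 1))` and the moment
generating function of `q` is a product. For the negative ones
`Γ(k) q ^ (-k) = ∫₀^∞ s ^ (k - 1) exp (-s q) ds`, and the Laplace transform of `q` is at most
`(1 + s / M) ^ (-M)` with `M = N / (2b)`, that of a Gamma variable, whose negative moments are known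
(`lintegral_rpow_neg_le_of_laplace`, `lintegral_quadForm_rpow_neg_le`).

Moments are Lebesgue integrals of `ℝ≥0∞`-valued powers, so that `0 ^ (-k) = ∞` and finiteness of a
negative moment excludes the value `0`.
-/

open scoped ENNReal

namespace RandomProduct

/-! ### Negative moments from Laplace transforms -/

theorem lintegral_rpow_mul_exp_neg_mul_Ioi {a r : ℝ} (ha : 0 < a) (hr : 0 < r) :
    ∫⁻ t in Set.Ioi (0 : ℝ), ENNReal.ofReal (t ^ (a - 1) * Real.exp (-(r * t))) =
      ENNReal.ofReal ((1 / r) ^ a * Real.Gamma a) := by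
  have h := Real.integral_rpow_mul_exp_neg_mul_Ioi ha hr
  rw [← h, ofReal_integral_eq_lintegral_ofReal]
  · by_contra hc
    rw [integral_undef hc] at h
    have : 0 < (1 / r) ^ a * Real.Gamma a := by
      have := Real.Gamma_pos_of_pos ha
      positivity
    exact this.ne h
  · filter_upwards [ae_restrict_mem measurableSet_Ioi] with t ht
    have : 0 < t := ht
    simp only [Pi.zero_apply]
    positivity

/-- At `q = 0` both sides are infinite. -/
theorem ofReal_rpow_neg_le_lintegral {q : ℝ} (hq : 0 ≤ q) {k : ℕ} (hk : 1 ≤ k) :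
    ENNReal.ofReal (Real.Gamma k) * ENNReal.ofReal q ^ (-(k : ℝ)) ≤
      ∫⁻ s in Set.Ioi (0 : ℝ), ENNReal.ofReal (s ^ ((k : ℝ) - 1) * Real.exp (-(q * s))) := by
  have hk' : (0 : ℝ) < k := by exact_mod_cast hk
  rcases hq.eq_or_lt with rfl | hq
  · have : ∫⁻ s in Set.Ioi (0 : ℝ), ENNReal.ofReal (s ^ ((k : ℝ) - 1) * Real.exp (-(0 * s)))
        = ⊤ := by
      refine top_unique ?_
      calc (⊤ : ℝ≥0∞) = ∫⁻ _ in Set.Ioi (1 : ℝ), 1 := by simp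
        _ ≤ ∫⁻ s in Set.Ioi (1 : ℝ), ENNReal.ofReal (s ^ ((k : ℝ) - 1) * Real.exp (-(0 * s))) := by
            refine setLIntegral_mono' measurableSet_Ioi fun s hs => ?_
            have hs' : (1 : ℝ) ≤ s := le_of_lt hs
            have hk1 : (1 : ℝ) ≤ k := by exact_mod_cast hk
            simpa using Real.one_le_rpow hs' (sub_nonneg.2 hk1)
        _ ≤ _ := lintegral_mono_set (Set.Ioi_subset_Ioi zero_le_one)
    rw [this]
    exact le_top
  · rw [lintegral_rpow_mul_exp_neg_mul_Ioi hk' hq, ENNReal.ofReal_rpow_of_pos hq,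
      ← ENNReal.ofReal_mul (Real.Gamma_nonneg_of_nonneg hk'.le), mul_comm, one_div,
      Real.inv_rpow hq.le, ← Real.rpow_neg hq.le]

/-- The negative moment of order `k` of the Gamma law of shape and rate `M`. -/
theorem pow_mul_Gamma_div_le {M : ℝ} {k : ℕ} (hkM : 2 * k ≤ M) (hM : 0 < M) :
    M ^ k * Real.Gamma (M - k) / Real.Gamma M ≤ Real.exp (k * (k + 1) / M) := by
  induction k with
  | zero => simp [div_self (Real.Gamma_pos_of_pos hM).ne']
  | succ k ih =>
    push_cast at hkM ⊢
    have ih := ih (by linarith)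
    have hk0 : (0 : ℝ) ≤ k := k.cast_nonneg
    have h1 : 0 < M - (k + 1) := by linarith
    have hG : Real.Gamma (M - k) = (M - (k + 1)) * Real.Gamma (M - (k + 1)) := by
      rw [← Real.Gamma_add_one h1.ne']; ring_nf
    have h2 : M / (M - (k + 1)) ≤ Real.exp (2 * (k + 1) / M) := by
      rw [div_le_iff₀ h1]
      have h3 := Real.add_one_le_exp (2 * ((k : ℝ) + 1) / M)
      have h4 : M ≤ (2 * ((k : ℝ) + 1) / M + 1) * (M - (k + 1)) := by
        have : (2 * ((k : ℝ) + 1) / M + 1) * (M - (k + 1)) =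
            M + (k + 1) * (M - 2 * (k + 1)) / M := by field_simp; ring
        rw [this]
        have : 0 ≤ ((k : ℝ) + 1) * (M - 2 * (k + 1)) / M := by
          have : 0 ≤ M - 2 * ((k : ℝ) + 1) := by linarith
          positivity
        linarith
      exact h4.trans (mul_le_mul_of_nonneg_right h3 h1.le)
    have hGM := Real.Gamma_pos_of_pos hM
    calc M ^ (k + 1) * Real.Gamma (M - (k + 1)) / Real.Gamma M
        = (M ^ k * Real.Gamma (M - k) / Real.Gamma M) * (M / (M - (k + 1))) := by
          rw [hG]; field_simp; ring
      _ ≤ Real.exp (k * (k + 1) / M) * Real.exp (2 * (k + 1) / M) := by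
          have : 0 ≤ M / (M - (k + 1)) := by positivity
          gcongr
      _ = Real.exp ((k + 1) * (k + 1 + 1) / M) := by
          rw [← Real.exp_add]; congr 1; field_simp; ring

/-- A Beta integral, from writing `Γ(M) (1 + s / M) ^ (-M)` as a Laplace transform in `s` and exchanging
the integrals. -/
theorem lintegral_rpow_mul_one_add_rpow_neg {M : ℝ} {k : ℕ} (hk : 1 ≤ k) (hkM : k < M) :
    ENNReal.ofReal (Real.Gamma M) *
      ∫⁻ s in Set.Ioi (0 : ℝ), ENNReal.ofReal (s ^ ((k : ℝ) - 1) * (1 + s / M) ^ (-M)) =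
      ENNReal.ofReal (Real.Gamma k * (M ^ k * Real.Gamma (M - k))) := by
  have hk' : (0 : ℝ) < k := by exact_mod_cast hk
  have hM : 0 < M := hk'.trans hkM
  have hGk := Real.Gamma_pos_of_pos hk'
  have hGM := Real.Gamma_pos_of_pos hM
  have h1 : ∀ s ∈ Set.Ioi (0 : ℝ), ENNReal.ofReal (Real.Gamma M) *
      ENNReal.ofReal (s ^ ((k : ℝ) - 1) * (1 + s / M) ^ (-M)) =
      ∫⁻ x in Set.Ioi (0 : ℝ), ENNReal.ofReal (s ^ ((k : ℝ) - 1)) *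
        ENNReal.ofReal (x ^ (M - 1) * Real.exp (-((1 + s / M) * x))) := by
    intro s hs
    have hs : 0 < s := hs
    have h2 : 0 < 1 + s / M := by positivity
    rw [lintegral_const_mul _ (by fun_prop), lintegral_rpow_mul_exp_neg_mul_Ioi hM h2,
      ← ENNReal.ofReal_mul hGM.le, ← ENNReal.ofReal_mul (by positivity), one_div,
      Real.inv_rpow h2.le, ← Real.rpow_neg h2.le]
    congr 1; ring
  have h3 : ∀ x ∈ Set.Ioi (0 : ℝ), ∫⁻ s in Set.Ioi (0 : ℝ), ENNReal.ofReal (s ^ ((k : ℝ) - 1)) *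
        ENNReal.ofReal (x ^ (M - 1) * Real.exp (-((1 + s / M) * x))) =
      ENNReal.ofReal (Real.Gamma k * M ^ k) *
        ENNReal.ofReal (x ^ (M - k - 1) * Real.exp (-(1 * x))) := by
    intro x hx
    have hx : 0 < x := hx
    have h4 : ∀ s ∈ Set.Ioi (0 : ℝ), ENNReal.ofReal (s ^ ((k : ℝ) - 1)) *
        ENNReal.ofReal (x ^ (M - 1) * Real.exp (-((1 + s / M) * x))) =
        ENNReal.ofReal (x ^ (M - 1) * Real.exp (-x)) *
          ENNReal.ofReal (s ^ ((k : ℝ) - 1) * Real.exp (-((x / M) * s))) := by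
      intro s hs
      have hs : 0 < s := hs
      rw [← ENNReal.ofReal_mul (by positivity), ← ENNReal.ofReal_mul (by positivity)]
      congr 1
      have : Real.exp (-((1 + s / M) * x)) = Real.exp (-x) * Real.exp (-((x / M) * s)) := by
        rw [← Real.exp_add]; congr 1; ring
      rw [this]; ring
    rw [setLIntegral_congr_fun measurableSet_Ioi h4, lintegral_const_mul _ (by fun_prop),
      lintegral_rpow_mul_exp_neg_mul_Ioi hk' (by positivity), ← ENNReal.ofReal_mul (by positivity),
      ← ENNReal.ofReal_mul (by positivity)]
    congr 1
    have : x ^ (M - 1) = x ^ (M - k - 1) * x ^ k := by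
      rw [← Real.rpow_natCast, ← Real.rpow_add hx]; ring_nf
    rw [this, Real.rpow_natCast]
    field_simp
    rw [← mul_pow, mul_div_cancel₀ _ hx.ne']
  rw [← lintegral_const_mul _ (by fun_prop), setLIntegral_congr_fun measurableSet_Ioi h1,
    lintegral_lintegral_swap (by fun_prop), setLIntegral_congr_fun measurableSet_Ioi h3,
    lintegral_const_mul _ (by fun_prop),
    lintegral_rpow_mul_exp_neg_mul_Ioi (by linarith) one_pos,
    ← ENNReal.ofReal_mul (by positivity)]
  congr 1
  simp; ring

/-- A nonnegative random variable whose Laplace transform is at most that of the Gamma law of shape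
and rate `M` has negative moments at most those of that law. -/
theorem lintegral_rpow_neg_le_of_laplace {α : Type*} [MeasurableSpace α] {ν : Measure α}
    [SFinite ν] {q : α → ℝ} (hq : Measurable q) (hq0 : ∀ x, 0 ≤ q x) {M : ℝ} {k : ℕ} (hk : 1 ≤ k)
    (hkM : 2 * k ≤ M)
    (hL : ∀ s, 0 < s → ∫⁻ x, ENNReal.ofReal (Real.exp (-(q x * s))) ∂ν ≤
      ENNReal.ofReal ((1 + s / M) ^ (-M))) :
    ∫⁻ x, ENNReal.ofReal (q x) ^ (-(k : ℝ)) ∂ν ≤ ENNReal.ofReal (Real.exp (k * (k + 1) / M)) := by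
  have hk' : (0 : ℝ) < k := by exact_mod_cast hk
  have hM : 0 < M := by linarith
  have hGk := Real.Gamma_pos_of_pos hk'
  have hGM := Real.Gamma_pos_of_pos hM
  have h1 : ENNReal.ofReal (Real.Gamma k) * ∫⁻ x, ENNReal.ofReal (q x) ^ (-(k : ℝ)) ∂ν ≤
      ∫⁻ s in Set.Ioi (0 : ℝ), ENNReal.ofReal (s ^ ((k : ℝ) - 1) * (1 + s / M) ^ (-M)) := by
    calc _ = ∫⁻ x, ENNReal.ofReal (Real.Gamma k) * ENNReal.ofReal (q x) ^ (-(k : ℝ)) ∂ν :=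
          (lintegral_const_mul _ (by fun_prop)).symm
      _ ≤ ∫⁻ x, (∫⁻ s in Set.Ioi (0 : ℝ),
            ENNReal.ofReal (s ^ ((k : ℝ) - 1) * Real.exp (-(q x * s)))) ∂ν :=
          lintegral_mono fun x => ofReal_rpow_neg_le_lintegral (hq0 x) hk
      _ = ∫⁻ s in Set.Ioi (0 : ℝ), ∫⁻ x,
            ENNReal.ofReal (s ^ ((k : ℝ) - 1) * Real.exp (-(q x * s))) ∂ν :=
          lintegral_lintegral_swap (by fun_prop)
      _ ≤ _ := by
          refine setLIntegral_mono' measurableSet_Ioi fun s hs => ?_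
          have hs : 0 < s := hs
          have h0 : 0 ≤ s ^ ((k : ℝ) - 1) := by positivity
          simp_rw [ENNReal.ofReal_mul h0]
          rw [lintegral_const_mul _ (by fun_prop)]
          gcongr
          exact hL s hs
  have h2 := lintegral_rpow_mul_one_add_rpow_neg hk (by linarith : (k : ℝ) < M)
  have h3 : ENNReal.ofReal (Real.Gamma M * Real.Gamma k) *
      ∫⁻ x, ENNReal.ofReal (q x) ^ (-(k : ℝ)) ∂ν ≤
      ENNReal.ofReal (Real.Gamma M * Real.Gamma k) *
        ENNReal.ofReal (Real.exp (k * (k + 1) / M)) := by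
    rw [ENNReal.ofReal_mul hGM.le, mul_assoc]
    refine (mul_le_mul_right h1 _).trans ?_
    rw [h2, ← ENNReal.ofReal_mul hGM.le, ← ENNReal.ofReal_mul (by positivity)]
    refine ENNReal.ofReal_le_ofReal ?_
    have := pow_mul_Gamma_div_le hkM hM
    rw [div_le_iff₀ hGM] at this
    calc _ ≤ Real.Gamma k * (Real.exp (k * (k + 1) / M) * Real.Gamma M) := by gcongr
      _ = _ := by ring
  exact (ENNReal.mul_le_mul_iff_right (by simpa using mul_pos hGM hGk)
    ENNReal.ofReal_ne_top).1 h3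

/-! ### Quadratic forms in independent standard Gaussian variables -/

theorem lintegral_exp_mul_sq_gaussianReal {c : ℝ} (hc : c < 1 / 2) :
    ∫⁻ x, ENNReal.ofReal (Real.exp (c * x ^ 2)) ∂(gaussianReal 0 1) =
      ENNReal.ofReal ((√(1 - 2 * c))⁻¹) := by
  have hc' : 0 < 1 / 2 - c := by linarith
  rw [gaussianReal_of_var_ne_zero _ one_ne_zero,
    lintegral_withDensity_eq_lintegral_mul _ (measurable_gaussianPDF _ _) (by fun_prop)]
  have h1 : ∀ x : ℝ, (gaussianPDF 0 1 * fun x => ENNReal.ofReal (Real.exp (c * x ^ 2))) x =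
      ENNReal.ofReal ((√(2 * Real.pi))⁻¹ * Real.exp (-(1 / 2 - c) * x ^ 2)) := by
    intro x
    simp only [Pi.mul_apply, gaussianPDF, gaussianPDFReal]
    rw [← ENNReal.ofReal_mul (by positivity), mul_assoc, ← Real.exp_add]
    congr 2
    · simp
    · congr 1; simp; ring
  simp_rw [h1]
  rw [← ofReal_integral_eq_lintegral_ofReal ((integrable_exp_neg_mul_sq hc').const_mul _)
    (Filter.Eventually.of_forall fun x => by positivity), integral_const_mul, integral_gaussian,
    ← Real.sqrt_inv, ← Real.sqrt_inv, ← Real.sqrt_mul (by positivity)]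
  congr 2
  have : 1 - 2 * c ≠ 0 := by linarith
  field_simp

theorem lintegral_exp_sum_mul_sq_pi {ι : Type*} [Fintype ι] {c : ι → ℝ} (hc : ∀ i, c i < 1 / 2) :
    ∫⁻ x, ENNReal.ofReal (Real.exp (∑ i, c i * x i ^ 2)) ∂(Measure.pi fun _ : ι => gaussianReal 0 1)
      = ENNReal.ofReal (∏ i, (√(1 - 2 * c i))⁻¹) := by
  have hm : ∀ i, Measurable fun x : ℝ => ENNReal.ofReal (Real.exp (c i * x ^ 2)) :=
    fun i => by fun_prop
  have h := lintegral_prod_eq_prod_lintegral_of_indepFun Finset.univ _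
    (iIndepFun_pi (μ := fun _ : ι => gaussianReal 0 1) fun i => (hm i).aemeasurable)
    (fun i => (hm i).comp (measurable_pi_apply i))
  simp_rw [Real.exp_sum]
  simp_rw [ENNReal.ofReal_prod_of_nonneg fun i _ => (Real.exp_pos _).le]
  rw [h, ENNReal.ofReal_prod_of_nonneg fun i _ => by positivity]
  refine Finset.prod_congr rfl fun i _ => ?_
  rw [← lintegral_exp_mul_sq_gaussianReal (hc i)]
  exact (measurePreserving_eval (fun _ : ι => gaussianReal 0 1) i).lintegral_comp (hm i)

theorem inv_sqrt_one_sub_le {x : ℝ} (h0 : 0 ≤ x) (h1 : x ≤ 1 / 2) :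
    (√(1 - x))⁻¹ ≤ Real.exp ((x + x ^ 2) / 2) := by
  have h2 := Real.quadratic_le_exp_of_nonneg (show 0 ≤ x + x ^ 2 by positivity)
  have h3 : 1 ≤ (1 - x) * Real.exp (x + x ^ 2) := by
    refine le_trans ?_ (mul_le_mul_of_nonneg_left h2 (by linarith))
    have : (1 - x) * (1 + (x + x ^ 2) + (x + x ^ 2) ^ 2 / 2) - 1 =
      x ^ 2 / 2 * ((1 - 2 * x) + x * (1 - x - x ^ 2)) := by ring
    have h4 : 0 ≤ x ^ 2 / 2 * ((1 - 2 * x) + x * (1 - x - x ^ 2)) := by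
      have : 0 ≤ 1 - x - x ^ 2 := by nlinarith
      have : 0 ≤ 1 - 2 * x := by linarith
      positivity
    linarith
  have h4 : Real.exp ((x + x ^ 2) / 2) = √(Real.exp (x + x ^ 2)) := by
    rw [Real.exp_half]
  have h5 : 0 < 1 - x := by linarith
  rw [h4, ← Real.sqrt_inv]
  refine Real.sqrt_le_sqrt ?_
  rwa [inv_le_iff_one_le_mul₀' h5]

section QuadForm

variable {ι : Type*} [Fintype ι]

/-- The exponential moment is a product of one-dimensional ones; the linear terms add up
to `r`. -/
theorem lintegral_exp_quadForm_le {a : ι → ℝ} {b N r : ℝ} (hN : 0 < N)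
    (ha0 : ∀ i, 0 ≤ a i) (hab : ∀ i, a i ≤ b) (hsum : ∑ i, a i = N) (hr : 0 ≤ r)
    (hrb : 4 * b * r ≤ N) :
    ∫⁻ x, ENNReal.ofReal (Real.exp (r * ((∑ i, a i * x i ^ 2) / N)))
        ∂(Measure.pi fun _ : ι => gaussianReal 0 1) ≤
      ENNReal.ofReal (Real.exp (r + 2 * b * r ^ 2 / N)) := by
  have hx0 : ∀ i, 0 ≤ 2 * r * a i / N := fun i => by have := ha0 i; positivity
  have hx1 : ∀ i, 2 * r * a i / N ≤ 1 / 2 := fun i => by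
    rw [div_le_iff₀ hN]
    nlinarith [mul_le_mul_of_nonneg_left (hab i) hr]
  have h1 : ∀ x : ι → ℝ, r * ((∑ i, a i * x i ^ 2) / N) = ∑ i, (r * a i / N) * x i ^ 2 := by
    intro x
    rw [Finset.sum_div, Finset.mul_sum]
    exact Finset.sum_congr rfl fun i _ => by ring
  simp_rw [h1]
  rw [lintegral_exp_sum_mul_sq_pi fun i => by
    have := hx1 i
    rw [show 2 * r * a i / N = 2 * (r * a i / N) by ring] at this
    linarith]
  refine ENNReal.ofReal_le_ofReal ?_
  calc ∏ i, (√(1 - 2 * (r * a i / N)))⁻¹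
      ≤ ∏ i, Real.exp ((2 * r * a i / N + (2 * r * a i / N) ^ 2) / 2) := by
        refine Finset.prod_le_prod (fun i _ => by positivity) fun i _ => ?_
        rw [show 2 * (r * a i / N) = 2 * r * a i / N by ring]
        exact inv_sqrt_one_sub_le (hx0 i) (hx1 i)
    _ = Real.exp (∑ i, (r / N * a i + 2 * r ^ 2 / N ^ 2 * (a i * a i))) := by
        rw [Real.exp_sum]
        refine Finset.prod_congr rfl fun i _ => ?_
        congr 1; field_simp
    _ ≤ Real.exp (∑ i, (r / N * a i + 2 * r ^ 2 / N ^ 2 * (b * a i))) := by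
        refine Real.exp_le_exp.2 (Finset.sum_le_sum fun i _ => ?_)
        have := mul_le_mul_of_nonneg_right (hab i) (ha0 i)
        gcongr
    _ = _ := by
        rw [Finset.sum_add_distrib, ← Finset.mul_sum, ← Finset.mul_sum, ← Finset.mul_sum, hsum]
        congr 1; field_simp

/-- Concavity of the logarithm on `[0, b]` bounds the Laplace transform by that of the Gamma law of
shape and rate `N / (2b)`, as if `N / b` of the weights were equal to `b` and the others to `0`. -/
theorem lintegral_quadForm_rpow_neg_le {a : ι → ℝ} {b N : ℝ} (hN : 0 < N) (hb : 0 < b)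
    (ha0 : ∀ i, 0 ≤ a i) (hab : ∀ i, a i ≤ b) (hsum : ∑ i, a i = N) {k : ℕ} (hk : 1 ≤ k)
    (hkb : 4 * b * k ≤ N) :
    ∫⁻ x, ENNReal.ofReal ((∑ i, a i * x i ^ 2) / N) ^ (-(k : ℝ))
        ∂(Measure.pi fun _ : ι => gaussianReal 0 1) ≤
      ENNReal.ofReal (Real.exp (2 * b * (k * (k + 1)) / N)) := by
  have hM : 0 < N / (2 * b) := by positivity
  have h := lintegral_rpow_neg_le_of_laplace (ν := Measure.pi fun _ : ι => gaussianReal 0 1)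
    (q := fun x => (∑ i, a i * x i ^ 2) / N) (M := N / (2 * b)) (by fun_prop)
    (fun x => div_nonneg (Finset.sum_nonneg fun i _ => mul_nonneg (ha0 i) (sq_nonneg _)) hN.le) hk
    (by rw [le_div_iff₀ (by positivity)]; linarith) ?_
  · refine h.trans_eq ?_
    congr 2; field_simp
  intro s hs
  have h1 : ∀ x : ι → ℝ, -((∑ i, a i * x i ^ 2) / N * s) = ∑ i, (-(s * a i / N)) * x i ^ 2 := by
    intro x
    rw [Finset.sum_div, Finset.sum_mul, ← Finset.sum_neg_distrib]
    exact Finset.sum_congr rfl fun i _ => by ring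
  simp_rw [h1]
  have h2 : ∀ i, 0 ≤ s * a i / N := fun i => by have := ha0 i; positivity
  rw [lintegral_exp_sum_mul_sq_pi fun i => by linarith [h2 i]]
  refine ENNReal.ofReal_le_ofReal ?_
  have hS : 0 < 1 + s / (N / (2 * b)) := by positivity
  calc ∏ i, (√(1 - 2 * -(s * a i / N)))⁻¹
      ≤ ∏ i, (1 + s / (N / (2 * b))) ^ (-(a i / (2 * b))) := by
        refine Finset.prod_le_prod (fun i _ => by positivity) fun i _ => ?_
        have h3 := _root_.rpow_one_add_le_one_add_mul_self
          (s := s / (N / (2 * b))) (p := a i / b) (by have : 0 < s / (N / (2 * b)) := by positivity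
                                                      linarith)
          (div_nonneg (ha0 i) hb.le) ((div_le_one hb).2 (hab i))
        have h4 : a i / b * (s / (N / (2 * b))) = 2 * (s * a i / N) := by field_simp
        rw [h4] at h3
        have h5 : (1 + s / (N / (2 * b))) ^ (-(a i / (2 * b))) =
            (√((1 + s / (N / (2 * b))) ^ (a i / b)))⁻¹ := by
          rw [Real.sqrt_eq_rpow, ← Real.rpow_mul hS.le, ← Real.rpow_neg hS.le]
          congr 1; field_simp
        rw [h5]
        have : 0 < (1 + s / (N / (2 * b))) ^ (a i / b) := by positivity
        gcongr
        linarith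
    _ = (1 + s / (N / (2 * b))) ^ (-(N / (2 * b))) := by
        rw [← Real.rpow_sum_of_pos hS, Finset.sum_neg_distrib, ← Finset.sum_div, hsum]

end QuadForm

/-! ### Convexity -/

section Convexity

variable {α : Type*} [MeasurableSpace α] {ν : Measure α} [IsProbabilityMeasure ν] {R : α → ℝ}

theorem ofReal_exp_le_lintegral_of_mean_one (hR : Measurable R) (hR0 : ∀ x, 0 ≤ R x)
    (hR1 : ∫⁻ x, ENNReal.ofReal (R x) ∂ν = 1) {w : ℝ} (hw : 0 ≤ w) :
    ENNReal.ofReal (Real.exp w) ≤ ∫⁻ x, ENNReal.ofReal (Real.exp (R x * w)) ∂ν := by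
  have h : ∀ x, ENNReal.ofReal (Real.exp w) + ENNReal.ofReal (w * Real.exp w) * ENNReal.ofReal (R x)
      ≤ ENNReal.ofReal (Real.exp (R x * w)) + ENNReal.ofReal (w * Real.exp w) := by
    intro x
    have h1 : 0 ≤ w * Real.exp w := by positivity
    rw [← ENNReal.ofReal_mul h1, ← ENNReal.ofReal_add (by positivity) (mul_nonneg h1 (hR0 x)),
      ← ENNReal.ofReal_add (by positivity) h1]
    refine ENNReal.ofReal_le_ofReal ?_
    have h2 := Real.add_one_le_exp (w * (R x - 1))
    have h3 : Real.exp (R x * w) = Real.exp w * Real.exp (w * (R x - 1)) := by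
      rw [← Real.exp_add]; ring_nf
    rw [h3]
    nlinarith [mul_le_mul_of_nonneg_left h2 (Real.exp_pos w).le]
  have h4 := lintegral_mono (μ := ν) h
  rw [lintegral_add_left (by fun_prop), lintegral_const_mul _ (by fun_prop),
    lintegral_add_right _ (by fun_prop), hR1] at h4
  simp only [lintegral_const, measure_univ, mul_one] at h4
  exact (ENNReal.add_le_add_iff_right ENNReal.ofReal_ne_top).1 h4

theorem one_le_lintegral_rpow_neg_of_mean_one (hR : Measurable R) (hR0 : ∀ x, 0 ≤ R x)
    (hR1 : ∫⁻ x, ENNReal.ofReal (R x) ∂ν = 1) {p : ℝ} (hp : 0 < p) :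
    1 ≤ ∫⁻ x, ENNReal.ofReal (R x) ^ (-p) ∂ν := by
  have h : ∀ x, 1 + ENNReal.ofReal p
      ≤ ENNReal.ofReal (R x) ^ (-p) + ENNReal.ofReal p * ENNReal.ofReal (R x) := by
    intro x
    rcases (hR0 x).eq_or_lt with h0 | h0
    · rw [← h0, ENNReal.ofReal_zero, ENNReal.zero_rpow_of_neg (by linarith)]
      simp
    · rw [ENNReal.ofReal_rpow_of_pos h0, ← ENNReal.ofReal_one, ← ENNReal.ofReal_mul hp.le,
        ← ENNReal.ofReal_add zero_le_one hp.le, ← ENNReal.ofReal_add (by positivity) (by positivity)]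
      refine ENNReal.ofReal_le_ofReal ?_
      have h1 := Real.add_one_le_exp (Real.log (R x) * (-p))
      rw [← Real.rpow_def_of_pos h0] at h1
      nlinarith [Real.log_le_sub_one_of_pos h0]
  have h4 := lintegral_mono (μ := ν) h
  rw [lintegral_const, measure_univ, mul_one, lintegral_add_right _ (by fun_prop),
    lintegral_const_mul _ (by fun_prop), hR1, mul_one] at h4
  exact (ENNReal.add_le_add_iff_right ENNReal.ofReal_ne_top).1 h4

end Convexity

/-! ### The squared norm of a standard Gaussian vector -/

/-- The standard Gaussian measure on `Fin N → ℝ`. -/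
noncomputable abbrev gaussPi (N : ℕ) : Measure (Fin N → ℝ) := Measure.pi fun _ => gaussianReal 0 1

theorem lintegral_sq_gaussianReal :
    ∫⁻ x, ENNReal.ofReal (x ^ 2) ∂(gaussianReal 0 1) = 1 := by
  have h := variance_of_integral_eq_zero (X := id) (μ := gaussianReal 0 1) aemeasurable_id (by simp)
  have hi : Integrable (fun x : ℝ => x ^ 2) (gaussianReal 0 1) := by
    have := (memLp_id_gaussianReal (μ := 0) (v := 1) 2).integrable_sq
    simpa using this
  rw [← ofReal_integral_eq_lintegral_ofReal hi (Filter.Eventually.of_forall fun x => sq_nonneg x)]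
  simp only [variance_id_gaussianReal, id] at h
  simp [← h]

theorem lintegral_sum_sq_div_gaussPi {N : ℕ} (hN : 1 ≤ N) :
    ∫⁻ g, ENNReal.ofReal ((∑ i, g i ^ 2) / N) ∂(gaussPi N) = 1 := by
  have hN' : (0 : ℝ) < N := by exact_mod_cast hN
  have h : ∀ g : Fin N → ℝ, ENNReal.ofReal ((∑ i, g i ^ 2) / N) =
      ENNReal.ofReal (1 / N) * ∑ i, ENNReal.ofReal (g i ^ 2) := by
    intro g
    rw [← ENNReal.ofReal_sum_of_nonneg fun i _ => sq_nonneg _,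
      ← ENNReal.ofReal_mul (by positivity)]
    congr 1; ring
  simp_rw [h]
  rw [lintegral_const_mul _ (by fun_prop), lintegral_finsetSum _ fun i _ => by fun_prop]
  have h2 : ∀ i : Fin N, ∫⁻ g, ENNReal.ofReal (g i ^ 2) ∂(gaussPi N) = 1 := fun i => by
    rw [← lintegral_sq_gaussianReal]
    exact (measurePreserving_eval (fun _ : Fin N => gaussianReal 0 1) i).lintegral_comp
      (f := fun x : ℝ => ENNReal.ofReal (x ^ 2)) (by fun_prop)
  simp_rw [h2]
  simp only [Finset.sum_const, Finset.card_univ, Fintype.card_fin, nsmul_eq_mul, mul_one]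
  rw [← ENNReal.ofReal_natCast, ← ENNReal.ofReal_mul (by positivity)]
  simp [hN'.ne']

/-! ### Squared norms and squared singular values -/

section SingularValues

variable {N : ℕ}

theorem normApply_sq (A : Matrix (Fin N) (Fin N) ℝ) (v : EuclideanSpace ℝ (Fin N)) :
    normApply A v ^ 2 = ∑ i, (A *ᵥ v.ofLp) i ^ 2 := by
  rw [normApply, EuclideanSpace.real_norm_sq_eq]

theorem normApply_smul (A : Matrix (Fin N) (Fin N) ℝ) (c : ℝ) (v : EuclideanSpace ℝ (Fin N)) :
    normApply A (c • v) = |c| * normApply A v := by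
  rw [normApply, normApply, WithLp.ofLp_smul, mulVec_smul, WithLp.toLp_smul, norm_smul,
    Real.norm_eq_abs]

theorem normApply_eq_of_orthogonal {U : Matrix (Fin N) (Fin N) ℝ}
    (hU : U ∈ Matrix.orthogonalGroup (Fin N) ℝ) (A : Matrix (Fin N) (Fin N) ℝ)
    (v : EuclideanSpace ℝ (Fin N)) :
    normApply (Uᵀ * A * U) v ^ 2 = normApply A (WithLp.toLp 2 (U *ᵥ v.ofLp)) ^ 2 := by
  have h : U * Uᵀ = 1 := (Matrix.mem_orthogonalGroup_iff (Fin N) ℝ).1 hU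
  have key : ∀ x : Fin N → ℝ, ∑ i, (Uᵀ *ᵥ x) i ^ 2 = ∑ i, x i ^ 2 := by
    intro x
    have h1 : ∀ y : Fin N → ℝ, ∑ i, y i ^ 2 = y ⬝ᵥ y := fun y =>
      Finset.sum_congr rfl fun i _ => by ring
    rw [h1, h1, dotProduct_mulVec, vecMul_transpose, mulVec_mulVec, h, one_mulVec]
  rw [normApply_sq, normApply_sq, mul_assoc, ← mulVec_mulVec, key, ← mulVec_mulVec]

theorem sbar_eq_of_orthogonal {U : Matrix (Fin N) (Fin N) ℝ}
    (hU : U ∈ Matrix.orthogonalGroup (Fin N) ℝ) (A : Matrix (Fin N) (Fin N) ℝ) :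
    sbar (Uᵀ * A * U) = sbar A := by
  have h : U * Uᵀ = 1 := (Matrix.mem_orthogonalGroup_iff (Fin N) ℝ).1 hU
  rw [sbar_eq_trace, sbar_eq_trace]
  congr 1
  calc ((Uᵀ * A * U)ᵀ * (Uᵀ * A * U)).trace = (Uᵀ * (Aᵀ * (U * Uᵀ) * A) * U).trace := by
        simp only [transpose_mul, transpose_transpose, mul_assoc]
    _ = (Aᵀ * A).trace := by
        rw [h, mul_one, trace_mul_comm, ← mul_assoc, h, one_mul]

theorem sqSing_nonneg (A : Matrix (Fin N) (Fin N) ℝ) (k : Fin N) : 0 ≤ sqSing A k :=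
  (Matrix.posSemidef_conjTranspose_mul_self A).eigenvalues_nonneg k

theorem sum_sqSing (hN : 1 ≤ N) (A : Matrix (Fin N) (Fin N) ℝ) :
    ∑ k, sqSing A k = N * sbar A := by
  have : (N : ℝ) ≠ 0 := by positivity
  rw [sbar]; field_simp

theorem sbar_nonneg (A : Matrix (Fin N) (Fin N) ℝ) : 0 ≤ sbar A :=
  mul_nonneg (by positivity) (Finset.sum_nonneg fun k _ => sqSing_nonneg A k)

theorem sbar_pos (hN : 1 ≤ N) {A : Matrix (Fin N) (Fin N) ℝ} (hA : A ≠ 0) : 0 < sbar A := by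
  refine (sbar_nonneg A).lt_of_ne' fun h => hA ?_
  rw [sbar_eq_trace] at h
  have hN' : (1 / (N : ℝ)) ≠ 0 := by positivity
  have h2 := (mul_eq_zero.1 h).resolve_left hN'
  rw [← conjTranspose_eq_transpose_of_trivial] at h2
  exact Matrix.trace_conjTranspose_mul_self_eq_zero_iff.1 h2

theorem measurable_entry (i j : Fin N) :
    Measurable fun A : Matrix (Fin N) (Fin N) ℝ => A i j :=
  (measurable_pi_apply j).comp (measurable_pi_apply (X := fun _ : Fin N => Fin N → ℝ) i)

theorem measurable_sbar : Measurable (sbar : Matrix (Fin N) (Fin N) ℝ → ℝ) := by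
  have h : (sbar : Matrix (Fin N) (Fin N) ℝ → ℝ) =
      fun A => (1 / (N : ℝ)) * ∑ i, ∑ j, A j i * A j i := by
    ext A
    rw [sbar_eq_trace]
    rfl
  rw [h]
  refine measurable_const.mul (Finset.measurable_sum _ fun i _ => Finset.measurable_sum _
    fun j _ => (measurable_entry j i).mul (measurable_entry j i))

theorem measurable_mulVec : Measurable
    fun p : Matrix (Fin N) (Fin N) ℝ × (Fin N → ℝ) => p.1 *ᵥ p.2 := by
  refine measurable_pi_lambda _ fun i => ?_
  simp only [mulVec, dotProduct]
  refine Finset.measurable_sum Finset.univ fun j _ => ?_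
  exact ((measurable_entry i j).comp measurable_fst).mul
    ((measurable_pi_apply (X := fun _ : Fin N => ℝ) j).comp measurable_snd)

theorem measurable_mulVec_left (x : Fin N → ℝ) :
    Measurable fun A : Matrix (Fin N) (Fin N) ℝ => A *ᵥ x := by
  have h : Measurable fun A : Matrix (Fin N) (Fin N) ℝ => (A, x) :=
    measurable_id.prodMk (measurable_const (a := x))
  have h2 := (measurable_mulVec (N := N)).comp h
  exact h2

theorem measurable_normApply : Measurable
    fun p : Matrix (Fin N) (Fin N) ℝ × EuclideanSpace ℝ (Fin N) => normApply p.1 p.2 := by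
  have h : Measurable fun p : Matrix (Fin N) (Fin N) ℝ × EuclideanSpace ℝ (Fin N) =>
      WithLp.toLp 2 (p.1 *ᵥ p.2.ofLp) := by
    refine (WithLp.measurable_toLp 2 _).comp (measurable_mulVec.comp
      (measurable_fst.prodMk ((WithLp.measurable_ofLp 2 _).comp measurable_snd)))
  exact h.norm

theorem measurable_normApply_left (v : EuclideanSpace ℝ (Fin N)) :
    Measurable fun A : Matrix (Fin N) (Fin N) ℝ => normApply A v := by
  have h : Measurable fun A : Matrix (Fin N) (Fin N) ℝ => (A, v) :=
    measurable_id.prodMk (measurable_const (a := v))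
  have h2 := (measurable_normApply (N := N)).comp h
  exact h2

/-- The images under `A` of the eigenvectors of `AᵀA` are orthogonal, of squared norms
`sqSing A i`. -/
theorem normApply_eigenvectorBasis_sum_sq (A : Matrix (Fin N) (Fin N) ℝ) (x : Fin N → ℝ) :
    normApply A (∑ i, x i • (Matrix.isHermitian_conjTranspose_mul_self A).eigenvectorBasis i) ^ 2 =
      ∑ i, sqSing A i * x i ^ 2 := by
  set hA := Matrix.isHermitian_conjTranspose_mul_self A
  set y : EuclideanSpace ℝ (Fin N) := ∑ i, x i • hA.eigenvectorBasis i with hy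
  have h1 : normApply A y ^ 2 = y.ofLp ⬝ᵥ ((Aᴴ * A) *ᵥ y.ofLp) := by
    rw [normApply_sq, ← mulVec_mulVec, dotProduct_mulVec, conjTranspose_eq_transpose_of_trivial,
      vecMul_transpose]
    exact Finset.sum_congr rfl fun i _ => by ring
  have h2 : (Aᴴ * A) *ᵥ y.ofLp =
      (∑ i, (sqSing A i * x i) • hA.eigenvectorBasis i : EuclideanSpace ℝ (Fin N)).ofLp := by
    simp only [hy, WithLp.ofLp_sum, WithLp.ofLp_smul, mulVec_sum, mulVec_smul,
      hA.mulVec_eigenvectorBasis]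
    refine Finset.sum_congr rfl fun i _ => ?_
    rw [smul_smul, mul_comm]; rfl
  have h3 : ∀ a c : EuclideanSpace ℝ (Fin N), a.ofLp ⬝ᵥ c.ofLp = inner ℝ a c := by
    intro a c
    rw [EuclideanSpace.inner_eq_star_dotProduct, dotProduct_comm]; simp
  rw [h1, h2, h3, hy, sum_inner]
  refine Finset.sum_congr rfl fun i _ => ?_
  rw [inner_smul_left, hA.eigenvectorBasis.orthonormal.inner_right_fintype]
  simp; ring

/-- By the rotation invariance of the standard Gaussian measure. -/
theorem lintegral_normApply_gaussPi (A : Matrix (Fin N) (Fin N) ℝ) {F : ℝ → ℝ≥0∞}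
    (hF : Measurable F) :
    ∫⁻ g, F (normApply A (WithLp.toLp 2 g) ^ 2) ∂(gaussPi N) =
      ∫⁻ g, F (∑ i, sqSing A i * g i ^ 2) ∂(gaussPi N) := by
  have hm : Measurable fun x : EuclideanSpace ℝ (Fin N) => F (normApply A x ^ 2) :=
    hF.comp ((measurable_normApply.comp (measurable_const.prodMk measurable_id)).pow_const 2)
  rw [← lintegral_map (f := fun x : EuclideanSpace ℝ (Fin N) => F (normApply A x ^ 2)) hm
    (WithLp.measurable_toLp 2 _), map_pi_eq_stdGaussian,
    stdGaussian_eq_map_pi_orthonormalBasis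
      (Matrix.isHermitian_conjTranspose_mul_self A).eigenvectorBasis, lintegral_map hm (by fun_prop)]
  simp_rw [normApply_eigenvectorBasis_sum_sq]

end SingularValues

/-! ### Rotationally invariant matrices -/

section Rotation

variable {N : ℕ}
   {Ω : Type*} [MeasurableSpace Ω] {μ : Measure Ω}
  {X : Ω → Matrix (Fin N) (Fin N) ℝ}

/-- The invariance of all joint laws of matrix coefficients, applied to the family of all pairs of
coordinate vectors. -/
theorem RotInvariant.map_conj (hN : 1 ≤ N) (hX : RotInvariant μ X)
    {U : Matrix (Fin N) (Fin N) ℝ} (hU : U ∈ Matrix.orthogonalGroup (Fin N) ℝ) :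
    μ.map X = μ.map fun ω => Uᵀ * X ω * U := by
  have h := hX (N * N) (Nat.mul_pos hN hN)
    (fun p => Pi.single (finProdFinEquiv.symm p).2 1)
    (fun p => Pi.single (finProdFinEquiv.symm p).1 1) U hU
  let T : (Fin (N * N) → ℝ) → Matrix (Fin N) (Fin N) ℝ :=
    fun x => Matrix.of fun i j => x (finProdFinEquiv (i, j))
  have hT : Measurable T := by
    refine measurable_pi_lambda _ fun i => measurable_pi_lambda _ fun j => ?_
    exact measurable_pi_apply _
  have h2 := (h.comp hT).map_eq
  have e1 : (T ∘ fun ω (p : Fin (N * N)) =>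
      (Pi.single (finProdFinEquiv.symm p).1 1 : Fin N → ℝ) ⬝ᵥ
        (X ω *ᵥ Pi.single (finProdFinEquiv.symm p).2 1)) = X := by
    ext ω i j
    simp only [T, Function.comp, of_apply, Equiv.symm_apply_apply]
    simp
  have e2 : (T ∘ fun ω (p : Fin (N * N)) =>
      (U *ᵥ (Pi.single (finProdFinEquiv.symm p).1 1 : Fin N → ℝ)) ⬝ᵥ
        (X ω *ᵥ (U *ᵥ Pi.single (finProdFinEquiv.symm p).2 1))) = fun ω => Uᵀ * X ω * U := by
    ext ω i j
    simp only [T, Function.comp, of_apply, Equiv.symm_apply_apply]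
    rw [mulVec_mulVec, dotProduct_mulVec, ← mulVec_transpose, dotProduct_single_one,
      mulVec_mulVec, mulVec_single_one, col_apply, transpose_mul, ← transpose_apply (_ * _ * _),
      transpose_mul, transpose_mul, transpose_transpose]
    simp only [transpose_transpose, mul_assoc]
  rwa [e1, e2] at h2

/-- A reflection does it. -/
theorem exists_orthogonal_mulVec_eq {x y : EuclideanSpace ℝ (Fin N)} (h : ‖x‖ = ‖y‖) :
    ∃ U ∈ Matrix.orthogonalGroup (Fin N) ℝ, U *ᵥ x.ofLp = y.ofLp := by
  let f := (ℝ ∙ (x - y))ᗮ.reflection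
  let b := EuclideanSpace.basisFun (Fin N) ℝ
  refine ⟨_, f.toMatrix_mem_unitaryGroup b b, ?_⟩
  have h2 := LinearMap.toMatrix_mulVec_repr b.toBasis b.toBasis f.toLinearMap x
  have h3 : f x = y := Submodule.reflection_sub h
  have h4 : ∀ z : EuclideanSpace ℝ (Fin N), ⇑(b.toBasis.repr z) = z.ofLp := by
    intro z; ext i; simp [b]
  rw [h4, h4] at h2
  rw [← h3]
  exact h2

theorem RotInvariant.lintegral_normApply_eq (hN : 1 ≤ N) (hX : RotInvariant μ X) (hm : Measurable X)
    {F : ℝ × ℝ → ℝ≥0∞} (hF : Measurable F) {u : EuclideanSpace ℝ (Fin N)} (hu : ‖u‖ = 1)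
    (x : EuclideanSpace ℝ (Fin N)) :
    ∫⁻ ω, F (normApply (X ω) x ^ 2, sbar (X ω)) ∂μ =
      ∫⁻ ω, F (‖x‖ ^ 2 * normApply (X ω) u ^ 2, sbar (X ω)) ∂μ := by
  obtain ⟨U, hU, hUx⟩ := exists_orthogonal_mulVec_eq (x := ‖x‖ • u) (y := x)
    (by simp [norm_smul, hu])
  have hFm : Measurable fun A : Matrix (Fin N) (Fin N) ℝ =>
      F (normApply A (‖x‖ • u) ^ 2, sbar A) :=
    hF.comp (((measurable_normApply_left _).pow_const 2).prodMk measurable_sbar)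
  have hUm : Measurable fun ω => Uᵀ * X ω * U := by
    refine measurable_pi_lambda _ fun i => measurable_pi_lambda _ fun j => ?_
    simp only [Matrix.mul_apply]
    exact Finset.measurable_sum _ fun k _ => (Finset.measurable_sum _ fun l _ =>
      measurable_const.mul ((measurable_entry l k).comp hm)).mul measurable_const
  have h1 := congrArg (fun ν => ∫⁻ A, F (normApply A (‖x‖ • u) ^ 2, sbar A) ∂ν)
    (hX.map_conj hN hU)
  simp only [lintegral_map hFm hm, lintegral_map hFm hUm, normApply_eq_of_orthogonal hU,
    sbar_eq_of_orthogonal hU, hUx] at h1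
  rw [← h1]
  simp only [normApply_smul, mul_pow, sq_abs]

/-- Averaging over a Gaussian vector `g` independent of `X`. Given `X`, the law of `‖X g‖²` is that
of `∑ sₖ gₖ²`; given `g`, the law of `(‖X g‖², s̄)` is that of `(‖g‖² ‖X u‖², s̄)`. -/
theorem RotInvariant.lintegral_gaussian_average [SFinite μ] (hN : 1 ≤ N) (hX : RotInvariant μ X)
    (hm : Measurable X) {F : ℝ × ℝ → ℝ≥0∞} (hF : Measurable F) {u : EuclideanSpace ℝ (Fin N)}
    (hu : ‖u‖ = 1) :
    ∫⁻ ω, ∫⁻ g, F ((∑ i, g i ^ 2) * normApply (X ω) u ^ 2, sbar (X ω)) ∂(gaussPi N) ∂μ =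
      ∫⁻ ω, ∫⁻ g, F (∑ i, sqSing (X ω) i * g i ^ 2, sbar (X ω)) ∂(gaussPi N) ∂μ := by
  have hs : Measurable fun ω => sbar (X ω) := measurable_sbar.comp hm
  have hn : Measurable fun ω => normApply (X ω) u :=
    (measurable_normApply_left u).comp hm
  have hgX : Measurable fun p : Ω × (Fin N → ℝ) =>
      (X p.1, (WithLp.toLp 2 p.2 : EuclideanSpace ℝ (Fin N))) :=
    (hm.comp measurable_fst).prodMk ((WithLp.measurable_toLp 2 (Fin N → ℝ)).comp measurable_snd)
  have hn2 : Measurable fun p : Ω × (Fin N → ℝ) => normApply (X p.1) (WithLp.toLp 2 p.2) := by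
    have h2 := (measurable_normApply (N := N)).comp hgX
    exact h2
  have hg : Measurable fun g : Fin N → ℝ => ∑ i, g i ^ 2 := by fun_prop
  have hm1 : Measurable fun p : Ω × (Fin N → ℝ) =>
      F ((∑ i, p.2 i ^ 2) * normApply (X p.1) u ^ 2, sbar (X p.1)) :=
    hF.comp (((hg.comp measurable_snd).mul ((hn.comp measurable_fst).pow_const 2)).prodMk
      (hs.comp measurable_fst))
  have hm2 : Measurable fun p : Ω × (Fin N → ℝ) =>
      F (normApply (X p.1) (WithLp.toLp 2 p.2) ^ 2, sbar (X p.1)) :=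
    hF.comp ((hn2.pow_const 2).prodMk (hs.comp measurable_fst))
  calc _ = ∫⁻ g, ∫⁻ ω, F ((∑ i, g i ^ 2) * normApply (X ω) u ^ 2, sbar (X ω)) ∂μ ∂(gaussPi N) :=
        lintegral_lintegral_swap hm1.aemeasurable
    _ = ∫⁻ g, ∫⁻ ω, F (normApply (X ω) (WithLp.toLp 2 g) ^ 2, sbar (X ω)) ∂μ ∂(gaussPi N) := by
        refine lintegral_congr fun g => ?_
        rw [hX.lintegral_normApply_eq hN hm hF hu (WithLp.toLp 2 g),
          EuclideanSpace.real_norm_sq_eq]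
    _ = ∫⁻ ω, ∫⁻ g, F (normApply (X ω) (WithLp.toLp 2 g) ^ 2, sbar (X ω)) ∂(gaussPi N) ∂μ :=
        (lintegral_lintegral_swap hm2.aemeasurable).symm
    _ = _ := lintegral_congr fun ω => lintegral_normApply_gaussPi (X ω)
        (F := fun y => F (y, sbar (X ω))) (hF.comp (measurable_id.prodMk measurable_const))

end Rotation

/-! ### Moments for one factor -/

section OneFactor

variable {N : ℕ} {Ω : Type*} [MeasurableSpace Ω] {μ : Measure Ω}
  {X : Ω → Matrix (Fin N) (Fin N) ℝ}

/-- The inequality `w ^ r ≤ exp (r (w - 1))`. -/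
theorem ofReal_rpow_le_ofReal_exp_sub {w r : ℝ} (hw : 0 ≤ w) (hr : 0 ≤ r) :
    ENNReal.ofReal w ^ r ≤ ENNReal.ofReal (Real.exp (-r)) * ENNReal.ofReal (Real.exp (w * r)) := by
  rw [ENNReal.ofReal_rpow_of_nonneg hw hr, ← ENNReal.ofReal_mul (by positivity), ← Real.exp_add]
  refine ENNReal.ofReal_le_ofReal ?_
  have h := Real.add_one_le_exp (w - 1)
  calc w ^ r ≤ Real.exp (w - 1) ^ r := Real.rpow_le_rpow hw (by linarith) hr
    _ = _ := by rw [← Real.exp_mul]; ring_nf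

theorem ofReal_exp_neg_mul_exp_le {b : ℝ} (hb : 0 < b) (k : ℕ) :
    ENNReal.ofReal (Real.exp (-k)) * ENNReal.ofReal (Real.exp (k + 2 * b * (k : ℝ) ^ 2 / N)) ≤
      ENNReal.ofReal (Real.exp (2 * b * (k * (k + 1)) / N)) := by
  rw [← ENNReal.ofReal_mul (by positivity), ← Real.exp_add]
  refine ENNReal.ofReal_le_ofReal (Real.exp_le_exp.2 ?_)
  rw [neg_add_cancel_left]
  have : (0 : ℝ) ≤ k := k.cast_nonneg
  gcongr
  linarith

section RotInvariant

variable [IsProbabilityMeasure μ] {b : ℝ}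

theorem sum_sqSing_mul_div {A : Matrix (Fin N) (Fin N) ℝ} (g : Fin N → ℝ) :
    (∑ i, sqSing A i * g i ^ 2) / sbar A / N = (∑ i, sqSing A i / sbar A * g i ^ 2) / N := by
  rw [Finset.sum_div]
  congr 1
  exact Finset.sum_congr rfl fun i _ => by ring

theorem sum_sqSing_div (hN : 1 ≤ N) {A : Matrix (Fin N) (Fin N) ℝ} (hA : A ≠ 0) :
    ∑ i, sqSing A i / sbar A = N := by
  rw [← Finset.sum_div, sum_sqSing hN, mul_div_cancel_right₀ _ (sbar_pos hN hA).ne']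

theorem RotInvariant.lintegral_rpow_le (hN : 1 ≤ N) (hX : RotInvariant μ X) (hm : Measurable X)
    (hb : 0 < b) (hXb : ∀ᵐ ω ∂μ, ∀ i, sqSing (X ω) i ≤ b * sbar (X ω))
    (hX0 : ∀ᵐ ω ∂μ, X ω ≠ 0) {u : EuclideanSpace ℝ (Fin N)} (hu : ‖u‖ = 1) {k : ℕ}
    (hkb : 4 * b * k ≤ N) :
    ∫⁻ ω, ENNReal.ofReal (normApply (X ω) u ^ 2 / sbar (X ω)) ^ (k : ℝ) ∂μ ≤
      ENNReal.ofReal (Real.exp (2 * b * (k * (k + 1)) / N)) := by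
  have hN' : (0 : ℝ) < N := by exact_mod_cast hN
  have hk : (0 : ℝ) ≤ k := k.cast_nonneg
  have hW : ∀ ω, 0 ≤ normApply (X ω) u ^ 2 / sbar (X ω) := fun ω =>
    div_nonneg (sq_nonneg _) (sbar_nonneg _)
  have hWm : Measurable fun ω => normApply (X ω) u ^ 2 / sbar (X ω) :=
    (((measurable_normApply_left u).comp hm).pow_const 2).div (measurable_sbar.comp hm)
  have havg := hX.lintegral_gaussian_average hN hm
    (F := fun p => ENNReal.ofReal (Real.exp (k * (p.1 / p.2 / N)))) (by fun_prop) hu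
  have h1 : ∫⁻ ω, ENNReal.ofReal (Real.exp (normApply (X ω) u ^ 2 / sbar (X ω) * k)) ∂μ ≤
      ENNReal.ofReal (Real.exp (k + 2 * b * (k : ℝ) ^ 2 / N)) := by
    calc _ ≤ ∫⁻ ω, ∫⁻ g, ENNReal.ofReal (Real.exp (k * ((∑ i, g i ^ 2) *
            normApply (X ω) u ^ 2 / sbar (X ω) / N))) ∂(gaussPi N) ∂μ := by
          refine lintegral_mono fun ω => ?_
          refine (ofReal_exp_le_lintegral_of_mean_one (ν := gaussPi N) (by fun_prop)
            (fun g => by positivity) (lintegral_sum_sq_div_gaussPi hN)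
            (mul_nonneg (hW ω) hk)).trans_eq ?_
          refine lintegral_congr fun g => ?_
          congr 2; ring
      _ = _ := havg
      _ ≤ ∫⁻ _, ENNReal.ofReal (Real.exp (k + 2 * b * (k : ℝ) ^ 2 / N)) ∂μ := by
          refine lintegral_mono_ae ?_
          filter_upwards [hXb, hX0] with ω hωb hω0
          simp_rw [sum_sqSing_mul_div]
          exact lintegral_exp_quadForm_le hN' (fun i => div_nonneg (sqSing_nonneg _ _)
            (sbar_nonneg _)) (fun i => (div_le_iff₀ (sbar_pos hN hω0)).2 (hωb i))
            (sum_sqSing_div hN hω0) hk hkb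
      _ = _ := by simp
  calc _ ≤ ∫⁻ ω, ENNReal.ofReal (Real.exp (-k)) *
        ENNReal.ofReal (Real.exp (normApply (X ω) u ^ 2 / sbar (X ω) * k)) ∂μ :=
        lintegral_mono fun ω => ofReal_rpow_le_ofReal_exp_sub (hW ω) hk
    _ = ENNReal.ofReal (Real.exp (-k)) *
        ∫⁻ ω, ENNReal.ofReal (Real.exp (normApply (X ω) u ^ 2 / sbar (X ω) * k)) ∂μ :=
        lintegral_const_mul _ (hWm.mul_const _).exp.ennreal_ofReal
    _ ≤ _ := by gcongr
    _ ≤ _ := ofReal_exp_neg_mul_exp_le hb k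

theorem RotInvariant.lintegral_rpow_neg_le (hN : 1 ≤ N) (hX : RotInvariant μ X) (hm : Measurable X)
    (hb : 0 < b) (hXb : ∀ᵐ ω ∂μ, ∀ i, sqSing (X ω) i ≤ b * sbar (X ω))
    (hX0 : ∀ᵐ ω ∂μ, X ω ≠ 0) {u : EuclideanSpace ℝ (Fin N)} (hu : ‖u‖ = 1) {k : ℕ} (hk1 : 1 ≤ k)
    (hkb : 4 * b * k ≤ N) :
    ∫⁻ ω, ENNReal.ofReal (normApply (X ω) u ^ 2 / sbar (X ω)) ^ (-(k : ℝ)) ∂μ ≤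
      ENNReal.ofReal (Real.exp (2 * b * (k * (k + 1)) / N)) := by
  have hN' : (0 : ℝ) < N := by exact_mod_cast hN
  have hk : (0 : ℝ) < k := by exact_mod_cast hk1
  have havg := hX.lintegral_gaussian_average hN hm
    (F := fun p => ENNReal.ofReal (p.1 / p.2 / N) ^ (-(k : ℝ))) (by fun_prop) hu
  calc _ ≤ ∫⁻ ω, ∫⁻ g, ENNReal.ofReal ((∑ i, g i ^ 2) *
            normApply (X ω) u ^ 2 / sbar (X ω) / N) ^ (-(k : ℝ)) ∂(gaussPi N) ∂μ := by
        refine lintegral_mono fun ω => ?_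
        have h1 : ∀ g : Fin N → ℝ, ENNReal.ofReal ((∑ i, g i ^ 2) *
            normApply (X ω) u ^ 2 / sbar (X ω) / N) ^ (-(k : ℝ)) =
            ENNReal.ofReal (normApply (X ω) u ^ 2 / sbar (X ω)) ^ (-(k : ℝ)) *
              ENNReal.ofReal ((∑ i, g i ^ 2) / N) ^ (-(k : ℝ)) := by
          intro g
          rw [← ENNReal.mul_rpow_of_ne_top ENNReal.ofReal_ne_top ENNReal.ofReal_ne_top,
            ← ENNReal.ofReal_mul (div_nonneg (sq_nonneg _) (sbar_nonneg _))]
          congr 2; ring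
        simp_rw [h1]
        rw [lintegral_const_mul _ (by fun_prop)]
        refine le_mul_of_one_le_right' ?_
        exact one_le_lintegral_rpow_neg_of_mean_one (by fun_prop) (fun g => by positivity)
          (lintegral_sum_sq_div_gaussPi hN) hk
    _ = _ := havg
    _ ≤ ∫⁻ _, ENNReal.ofReal (Real.exp (2 * b * (k * (k + 1)) / N)) ∂μ := by
        refine lintegral_mono_ae ?_
        filter_upwards [hXb, hX0] with ω hωb hω0
        simp_rw [sum_sqSing_mul_div]
        exact lintegral_quadForm_rpow_neg_le hN' hb (fun i => div_nonneg (sqSing_nonneg _ _)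
          (sbar_nonneg _)) (fun i => (div_le_iff₀ (sbar_pos hN hω0)).2 (hωb i))
          (sum_sqSing_div hN hω0) hk1 hkb
    _ = _ := by simp

end RotInvariant

/-! ### Gaussian matrices -/

section Gaussian

variable {σ : ℝ}

/-- The law of `X u` is `𝒩(0, (σ²/N) I)`, by comparison of characteristic functions. -/
theorem map_mulVec_eq_map_stdGaussian (hm : Measurable X)
    (hind : iIndepFun (fun (p : Fin N × Fin N) ω => X ω p.1 p.2) μ)
    (hlaw : ∀ j k, μ.map (fun ω => X ω j k) = gaussianReal 0 (σ ^ 2 / (N : ℝ)).toNNReal)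
    {u : EuclideanSpace ℝ (Fin N)} (hu : ‖u‖ = 1) :
    μ.map (fun ω => WithLp.toLp 2 (X ω *ᵥ u.ofLp)) =
      (stdGaussian (EuclideanSpace ℝ (Fin N))).map ((σ / √N) • ·) := by
  have := hind.isProbabilityMeasure
  have hYm : Measurable fun ω => (WithLp.toLp 2 (X ω *ᵥ u.ofLp) : EuclideanSpace ℝ (Fin N)) :=
    (WithLp.measurable_toLp 2 (Fin N → ℝ)).comp ((measurable_mulVec_left u.ofLp).comp hm)
  have hem : ∀ p : Fin N × Fin N, Measurable fun ω => X ω p.1 p.2 :=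
    fun p => (measurable_entry p.1 p.2).comp hm
  have := Measure.isProbabilityMeasure_map (μ := μ) hYm.aemeasurable
  have : IsProbabilityMeasure ((stdGaussian (EuclideanSpace ℝ (Fin N))).map ((σ / √N) • ·)) :=
    Measure.isProbabilityMeasure_map (by fun_prop)
  refine Measure.ext_of_charFun (funext fun t => ?_)
  let τ : EuclideanSpace ℝ (Fin N × Fin N) := WithLp.toLp 2 fun p => t p.1 * u p.2
  have hξm : Measurable fun ω (p : Fin N × Fin N) => X ω p.1 p.2 := measurable_pi_lambda _ hem
  have h1 : charFun (μ.map fun ω => WithLp.toLp 2 (X ω *ᵥ u.ofLp)) t =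
      charFun ((μ.map fun ω (p : Fin N × Fin N) => X ω p.1 p.2).map (WithLp.toLp 2)) τ := by
    rw [Measure.map_map (WithLp.measurable_toLp 2 _) hξm, charFun_apply, charFun_apply,
      integral_map hYm.aemeasurable (by fun_prop),
      integral_map ((WithLp.measurable_toLp 2 _).comp hξm).aemeasurable (by fun_prop)]
    congr 1
    ext ω
    congr 3
    simp only [PiLp.inner_apply, τ, Function.comp, mulVec, dotProduct, Fintype.sum_prod_type]
    refine Finset.sum_congr rfl fun i _ => ?_
    simp only [RCLike.inner_apply, conj_trivial, Finset.mul_sum]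
    exact Finset.sum_congr rfl fun j _ => by ring
  have h2 := (iIndepFun_iff_map_fun_eq_pi_map fun p => (hem p).aemeasurable).1 hind
  simp only [hlaw] at h2
  rw [h1, h2, charFun_pi, charFun_map_smul, charFun_stdGaussian]
  simp_rw [charFun_gaussianReal]
  rw [← Complex.exp_sum]
  congr 1
  have hv : ((σ ^ 2 / (N : ℝ)).toNNReal : ℝ) = σ ^ 2 / N := Real.coe_toNNReal _ (by positivity)
  have hτ : ∑ p, τ p ^ 2 = ‖t‖ ^ 2 := by
    have hu2 : ∑ j, u j ^ 2 = 1 := by rw [← EuclideanSpace.real_norm_sq_eq, hu, one_pow]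
    simp only [τ, Fintype.sum_prod_type, mul_pow, ← Finset.mul_sum, hu2, mul_one]
    rw [EuclideanSpace.real_norm_sq_eq]
  have h3 : (∑ p, -(σ ^ 2 / N * τ p ^ 2 / 2) : ℝ) = -‖(σ / √N) • t‖ ^ 2 / 2 := by
    rw [norm_smul, mul_pow, Real.norm_eq_abs, sq_abs, div_pow, Real.sq_sqrt (by positivity), ← hτ,
      Finset.sum_neg_distrib, ← Finset.sum_div, ← Finset.mul_sum]
    ring
  have h4 := congrArg (fun x : ℝ => (x : ℂ)) h3
  push_cast at h4
  rw [← h4]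
  refine Finset.sum_congr rfl fun p _ => ?_
  have hv' : (((σ ^ 2 / (N : ℝ)).toNNReal : ℝ) : ℂ) = σ ^ 2 / N := by rw [hv]; push_cast; rfl
  rw [hv']
  simp

/-- `‖X u‖² / σ²` has the law of a normalized chi-squared variable with `N` degrees of freedom. -/
theorem lintegral_normApply_gaussian (hN : 1 ≤ N) (hσ : 0 < σ) (hm : Measurable X)
    (hind : iIndepFun (fun (p : Fin N × Fin N) ω => X ω p.1 p.2) μ)
    (hlaw : ∀ j k, μ.map (fun ω => X ω j k) = gaussianReal 0 (σ ^ 2 / (N : ℝ)).toNNReal)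
    {u : EuclideanSpace ℝ (Fin N)} (hu : ‖u‖ = 1) {F : ℝ → ℝ≥0∞} (hF : Measurable F) :
    ∫⁻ ω, F (normApply (X ω) u ^ 2 / σ ^ 2) ∂μ = ∫⁻ g, F ((∑ i, 1 * g i ^ 2) / N) ∂(gaussPi N) := by
  have hN' : (0 : ℝ) < N := by exact_mod_cast hN
  have hYm : Measurable fun ω => (WithLp.toLp 2 (X ω *ᵥ u.ofLp) : EuclideanSpace ℝ (Fin N)) :=
    (WithLp.measurable_toLp 2 (Fin N → ℝ)).comp ((measurable_mulVec_left u.ofLp).comp hm)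
  have hG : Measurable fun x : EuclideanSpace ℝ (Fin N) => F (‖x‖ ^ 2 / σ ^ 2) := by fun_prop
  have h := lintegral_map (μ := μ) hG hYm
  refine h.symm.trans ?_
  rw [map_mulVec_eq_map_stdGaussian hm hind hlaw hu, lintegral_map hG (by fun_prop),
    ← map_pi_eq_stdGaussian, lintegral_map (by fun_prop) (WithLp.measurable_toLp 2 _)]
  refine lintegral_congr fun g => ?_
  rw [norm_smul, mul_pow, Real.norm_eq_abs, sq_abs, div_pow, Real.sq_sqrt hN'.le,
    EuclideanSpace.real_norm_sq_eq]
  congr 1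
  simp only [one_mul]
  field_simp

theorem lintegral_rpow_le_of_gaussian (hN : 1 ≤ N) (hσ : 0 < σ) (hm : Measurable X)
    (hind : iIndepFun (fun (p : Fin N × Fin N) ω => X ω p.1 p.2) μ)
    (hlaw : ∀ j k, μ.map (fun ω => X ω j k) = gaussianReal 0 (σ ^ 2 / (N : ℝ)).toNNReal)
    {u : EuclideanSpace ℝ (Fin N)} (hu : ‖u‖ = 1) {k : ℕ} (hkN : 4 * 1 * (k : ℝ) ≤ N) :
    ∫⁻ ω, ENNReal.ofReal (normApply (X ω) u ^ 2 / σ ^ 2) ^ (k : ℝ) ∂μ ≤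
      ENNReal.ofReal (Real.exp (2 * 1 * (k * (k + 1)) / N)) := by
  rw [lintegral_normApply_gaussian hN hσ hm hind hlaw hu
    (F := fun y => ENNReal.ofReal y ^ (k : ℝ)) (by fun_prop)]
  calc _ ≤ ∫⁻ g, ENNReal.ofReal (Real.exp (-k)) *
        ENNReal.ofReal (Real.exp (k * ((∑ i, 1 * g i ^ 2) / N))) ∂(gaussPi N) := by
        refine lintegral_mono fun g => ?_
        rw [mul_comm (k : ℝ)]
        exact ofReal_rpow_le_ofReal_exp_sub (by positivity) k.cast_nonneg
    _ = ENNReal.ofReal (Real.exp (-k)) *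
        ∫⁻ g, ENNReal.ofReal (Real.exp (k * ((∑ i, 1 * g i ^ 2) / N))) ∂(gaussPi N) :=
        lintegral_const_mul _ (by fun_prop)
    _ ≤ ENNReal.ofReal (Real.exp (-k)) *
        ENNReal.ofReal (Real.exp (k + 2 * 1 * (k : ℝ) ^ 2 / N)) := by
        gcongr
        exact lintegral_exp_quadForm_le (by exact_mod_cast hN) (fun _ => zero_le_one)
          (fun _ => le_rfl) (by simp) k.cast_nonneg hkN
    _ ≤ _ := ofReal_exp_neg_mul_exp_le one_pos k

theorem lintegral_rpow_neg_le_of_gaussian (hN : 1 ≤ N) (hσ : 0 < σ) (hm : Measurable X)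
    (hind : iIndepFun (fun (p : Fin N × Fin N) ω => X ω p.1 p.2) μ)
    (hlaw : ∀ j k, μ.map (fun ω => X ω j k) = gaussianReal 0 (σ ^ 2 / (N : ℝ)).toNNReal)
    {u : EuclideanSpace ℝ (Fin N)} (hu : ‖u‖ = 1) {k : ℕ} (hk : 1 ≤ k)
    (hkN : 4 * 1 * (k : ℝ) ≤ N) :
    ∫⁻ ω, ENNReal.ofReal (normApply (X ω) u ^ 2 / σ ^ 2) ^ (-(k : ℝ)) ∂μ ≤
      ENNReal.ofReal (Real.exp (2 * 1 * (k * (k + 1)) / N)) := by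
  rw [lintegral_normApply_gaussian hN hσ hm hind hlaw hu
    (F := fun y => ENNReal.ofReal y ^ (-(k : ℝ))) (by fun_prop)]
  exact lintegral_quadForm_rpow_neg_le (by exact_mod_cast hN) one_pos (fun _ => zero_le_one)
    (fun _ => le_rfl) (by simp) hk hkN

end Gaussian

end OneFactor

/-! ### Products of independent matrices -/

section Product

variable {N : ℕ} {Ω : Type*} [MeasurableSpace Ω] {μ : Measure Ω}

theorem matProd_congr {Y Z : ℕ → Matrix (Fin N) (Fin N) ℝ} {n : ℕ} (h : ∀ i < n, Y i = Z i) :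
    matProd Y n = matProd Z n := by
  induction n with
  | zero => rfl
  | succ n ih =>
    rw [matProd, matProd, h n n.lt_succ_self, ih fun i hi => h i (hi.trans n.lt_succ_self)]

theorem measurable_matProd {α : Type*} [MeasurableSpace α] {Y : ℕ → α → Matrix (Fin N) (Fin N) ℝ}
    (hY : ∀ i, Measurable (Y i)) (n : ℕ) : Measurable fun a => matProd (fun i => Y i a) n := by
  induction n with
  | zero => exact measurable_const
  | succ n ih =>
    refine measurable_pi_lambda _ fun i => measurable_pi_lambda _ fun j => ?_
    simp only [matProd, Matrix.mul_apply]
    exact Finset.measurable_sum _ fun k _ =>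
      ((measurable_entry i k).comp (hY n)).mul ((measurable_entry k j).comp ih)

theorem normApply_mul (A B : Matrix (Fin N) (Fin N) ℝ) (v : EuclideanSpace ℝ (Fin N)) :
    normApply (A * B) v = normApply A (WithLp.toLp 2 (B *ᵥ v.ofLp)) := by
  rw [normApply, normApply, mulVec_mulVec]

theorem normApply_eq_norm_mul {y : EuclideanSpace ℝ (Fin N)} (hy : y ≠ 0)
    (A : Matrix (Fin N) (Fin N) ℝ) : normApply A y = ‖y‖ * normApply A (‖y‖⁻¹ • y) := by
  have : ‖y‖ ≠ 0 := norm_ne_zero_iff.2 hy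
  rw [normApply_smul, abs_of_nonneg (by positivity), mul_inv_cancel_left₀ this]

/-- By homogeneity a bound at unit vectors gives one at every vector. If `y = 0` or `d = 0` the
ratio is `0`, and `1 ≤ C` is what is needed. -/
theorem lintegral_ratio_rpow_le [IsProbabilityMeasure μ] {X : Ω → Matrix (Fin N) (Fin N) ℝ}
    (hm : Measurable X) {D : Matrix (Fin N) (Fin N) ℝ → ℝ} (hD : Measurable D) {p : ℝ} {C : ℝ≥0∞}
    (hC : 1 ≤ C)
    (h : ∀ u : EuclideanSpace ℝ (Fin N), ‖u‖ = 1 →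
      ∫⁻ ω, ENNReal.ofReal (normApply (X ω) u ^ 2 / D (X ω)) ^ p ∂μ ≤ C)
    (y : EuclideanSpace ℝ (Fin N)) {d : ℝ} (hd : 0 ≤ d) :
    ∫⁻ ω, ENNReal.ofReal (normApply (X ω) y ^ 2 / (d * D (X ω))) ^ p ∂μ ≤
      ENNReal.ofReal (‖y‖ ^ 2 / d) ^ p * C := by
  by_cases h0 : y = 0 ∨ d = 0
  · have h1 : ∀ ω, normApply (X ω) y ^ 2 / (d * D (X ω)) = 0 := by
      intro ω
      rcases h0 with rfl | rfl
      · simp [normApply]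
      · simp
    have h2 : ‖y‖ ^ 2 / d = 0 := by
      rcases h0 with rfl | rfl <;> simp
    simp only [h1, h2, lintegral_const, measure_univ, mul_one]
    exact le_mul_of_one_le_right' hC
  · push Not at h0
    obtain ⟨hy, hd0⟩ := h0
    have hu : ‖(‖y‖⁻¹ • y)‖ = 1 := by
      rw [norm_smul, norm_inv, norm_norm, inv_mul_cancel₀ (norm_ne_zero_iff.2 hy)]
    have h1 : ∀ ω, ENNReal.ofReal (normApply (X ω) y ^ 2 / (d * D (X ω))) ^ p =
        ENNReal.ofReal (‖y‖ ^ 2 / d) ^ p *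
          ENNReal.ofReal (normApply (X ω) (‖y‖⁻¹ • y) ^ 2 / D (X ω)) ^ p := by
      intro ω
      rw [← ENNReal.mul_rpow_of_ne_top ENNReal.ofReal_ne_top ENNReal.ofReal_ne_top,
        ← ENNReal.ofReal_mul (by positivity), normApply_eq_norm_mul hy]
      congr 2
      rw [mul_pow, mul_div_mul_comm]
    have hWm : Measurable fun ω => normApply (X ω) (‖y‖⁻¹ • y) ^ 2 / D (X ω) :=
      (((measurable_normApply_left _).comp hm).pow_const 2).div (hD.comp hm)
    simp_rw [h1]
    rw [lintegral_const_mul _ (hWm.ennreal_ofReal.pow_const p)]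
    gcongr
    exact h _ hu

variable {X : ℕ → Ω → Matrix (Fin N) (Fin N) ℝ}

theorem indepFun_matProd_prod (hm : ∀ i, Measurable (X i)) (hind : iIndepFun X μ)
    {D : Matrix (Fin N) (Fin N) ℝ → ℝ} (hD : Measurable D) (n : ℕ) :
    IndepFun (fun ω => (matProd (fun i => X i ω) n, ∏ i ∈ Finset.range n, D (X i ω))) (X n) μ := by
  classical
  have h := hind.indepFun_finset (Finset.range n) {n} (by simp) hm
  let Y : ℕ → (Finset.range n → Matrix (Fin N) (Fin N) ℝ) → Matrix (Fin N) (Fin N) ℝ :=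
    fun i x => if hi : i ∈ Finset.range n then x ⟨i, hi⟩ else 0
  have hY : ∀ i, Measurable (Y i) := by
    intro i
    by_cases hi : i ∈ Finset.range n
    · simpa only [Y, hi, dif_pos] using measurable_pi_apply _
    · simp only [Y, hi, dif_neg, not_false_eq_true]
      exact measurable_const
  have hφ : Measurable fun x => (matProd (fun i => Y i x) n, ∏ i ∈ Finset.range n, D (Y i x)) :=
    (measurable_matProd hY n).prodMk (Finset.measurable_prod _ fun i _ => hD.comp (hY i))
  have hψ : Measurable fun x : ({n} : Finset ℕ) → Matrix (Fin N) (Fin N) ℝ =>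
      x ⟨n, Finset.mem_singleton_self n⟩ := measurable_pi_apply _
  have h2 := h.comp hφ hψ
  have e : ∀ ω, ∀ i < n, Y i (fun j : Finset.range n => X j ω) = X i ω := by
    intro ω i hi
    simp [Y, hi]
  have e1 : ((fun x => (matProd (fun i => Y i x) n, ∏ i ∈ Finset.range n, D (Y i x))) ∘
      fun ω (i : Finset.range n) => X i ω) =
      fun ω => (matProd (fun i => X i ω) n, ∏ i ∈ Finset.range n, D (X i ω)) := by
    ext1 ω
    simp only [Function.comp]
    rw [matProd_congr (e ω), Finset.prod_congr rfl fun i hi => by rw [e ω i (Finset.mem_range.1 hi)]]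
  rw [e1] at h2
  exact h2

/-- If `‖X u‖² / D(X)` has `p`-th moment at most `C` for every unit vector `u`, whatever the factor
`X`, then `‖Πₙ v‖² / ∏ D(Xᵢ)` has `p`-th moment at most `Cⁿ`: integrate over the last factor given
the previous ones. -/
theorem lintegral_matProd_rpow_le [IsProbabilityMeasure μ] (hm : ∀ i, Measurable (X i))
    (hind : iIndepFun X μ) {D : Matrix (Fin N) (Fin N) ℝ → ℝ} (hD : Measurable D)
    (hD0 : ∀ A, 0 ≤ D A) {p : ℝ} {C : ℝ≥0∞} (hC : 1 ≤ C)
    (h : ∀ i, ∀ u : EuclideanSpace ℝ (Fin N), ‖u‖ = 1 →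
      ∫⁻ ω, ENNReal.ofReal (normApply (X i ω) u ^ 2 / D (X i ω)) ^ p ∂μ ≤ C)
    {v : EuclideanSpace ℝ (Fin N)} (hv : ‖v‖ = 1) (n : ℕ) :
    ∫⁻ ω, ENNReal.ofReal (normApply (matProd (fun i => X i ω) n) v ^ 2 /
      ∏ i ∈ Finset.range n, D (X i ω)) ^ p ∂μ ≤ C ^ n := by
  induction n with
  | zero => simp [matProd, normApply, hv]
  | succ n ih =>
    let H : (Matrix (Fin N) (Fin N) ℝ × ℝ) × Matrix (Fin N) (Fin N) ℝ → ℝ≥0∞ := fun z =>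
      ENNReal.ofReal (normApply z.2 (WithLp.toLp 2 (z.1.1 *ᵥ v.ofLp)) ^ 2 / (z.1.2 * D z.2)) ^ p
    have hzm : Measurable fun z : (Matrix (Fin N) (Fin N) ℝ × ℝ) × Matrix (Fin N) (Fin N) ℝ =>
        (z.2, (WithLp.toLp 2 (z.1.1 *ᵥ v.ofLp) : EuclideanSpace ℝ (Fin N))) :=
      measurable_snd.prodMk ((WithLp.measurable_toLp 2 (Fin N → ℝ)).comp
        ((measurable_mulVec_left v.ofLp).comp (measurable_fst.comp measurable_fst)))
    have hzn := (measurable_normApply (N := N)).comp hzm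
    have hH : Measurable H :=
      ((hzn.pow_const 2).div ((measurable_snd.comp measurable_fst).mul
        (hD.comp measurable_snd))).ennreal_ofReal.pow_const p
    let P : Ω → Matrix (Fin N) (Fin N) ℝ × ℝ := fun ω =>
      (matProd (fun i => X i ω) n, ∏ i ∈ Finset.range n, D (X i ω))
    have hP : Measurable P := (measurable_matProd hm n).prodMk
      (Finset.measurable_prod _ fun i _ => hD.comp (hm i))
    have hPX := (indepFun_iff_map_prod_eq_prod_map_map hP.aemeasurable (hm n).aemeasurable).1
      (indepFun_matProd_prod hm hind hD n)
    have : SFinite (μ.map (X n)) := inferInstance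
    calc _ = ∫⁻ ω, H (P ω, X n ω) ∂μ := by
          refine lintegral_congr fun ω => ?_
          simp only [H, P, matProd, normApply_mul, Finset.prod_range_succ]
      _ = ∫⁻ z, H z ∂((μ.map P).prod (μ.map (X n))) := by
          rw [← hPX, lintegral_map hH (hP.prodMk (hm n))]
      _ = ∫⁻ ω, ∫⁻ ω', H (P ω, X n ω') ∂μ ∂μ := by
          rw [lintegral_prod _ hH.aemeasurable, lintegral_map hH.lintegral_prod_right' hP]
          refine lintegral_congr fun ω => ?_
          exact lintegral_map (hH.comp measurable_prodMk_left) (hm n)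
      _ ≤ ∫⁻ ω, ENNReal.ofReal (normApply (matProd (fun i => X i ω) n) v ^ 2 /
            ∏ i ∈ Finset.range n, D (X i ω)) ^ p * C ∂μ := by
          refine lintegral_mono fun ω => ?_
          exact lintegral_ratio_rpow_le (hm n) hD hC (h n) (WithLp.toLp 2 ((P ω).1 *ᵥ v.ofLp))
            (show 0 ≤ ∏ i ∈ Finset.range n, D (X i ω) from Finset.prod_nonneg fun i _ => hD0 _)
      _ = (∫⁻ ω, ENNReal.ofReal (normApply (matProd (fun i => X i ω) n) v ^ 2 /
            ∏ i ∈ Finset.range n, D (X i ω)) ^ p ∂μ) * C := by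
          refine lintegral_mul_const _ ?_
          exact ((((measurable_normApply_left v).comp (measurable_matProd hm n)).pow_const 2).div
            (Finset.measurable_prod _ fun i _ => hD.comp (hm i))).ennreal_ofReal.pow_const p
      _ ≤ C ^ n * C := by gcongr
      _ = C ^ (n + 1) := (pow_succ C n).symm

end Product

/-! ### Deviation bounds -/

/-- The event `Z = 0`, where `log Z` has a junk value, is controlled by the negative moment. -/
theorem measureReal_lt_abs_log_le {Ω : Type*} [MeasurableSpace Ω] {μ : Measure Ω}
    {Z : Ω → ℝ} (hZm : Measurable Z) (hZ : ∀ ω, 0 ≤ Z ω) {k : ℕ} (hk : 1 ≤ k) {a s : ℝ}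
    (hpos : ∫⁻ ω, ENNReal.ofReal (Z ω) ^ (k : ℝ) ∂μ ≤ ENNReal.ofReal (Real.exp a))
    (hneg : ∫⁻ ω, ENNReal.ofReal (Z ω) ^ (-(k : ℝ)) ∂μ ≤ ENNReal.ofReal (Real.exp a)) :
    μ.real {ω | Z ω = 0 ∨ s < |Real.log (Z ω)|} ≤ 2 * Real.exp (a - k * s) := by
  have hk' : (0 : ℝ) < k := by exact_mod_cast hk
  have markov : ∀ f : Ω → ℝ≥0∞, Measurable f → ∫⁻ ω, f ω ∂μ ≤ ENNReal.ofReal (Real.exp a) →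
      μ {ω | ENNReal.ofReal (Real.exp (k * s)) ≤ f ω} ≤ ENNReal.ofReal (Real.exp (a - k * s)) := by
    intro f hf hfa
    refine (meas_ge_le_lintegral_div hf.aemeasurable (by simp [Real.exp_pos])
      ENNReal.ofReal_ne_top).trans ?_
    rw [Real.exp_sub, ENNReal.ofReal_div_of_pos (Real.exp_pos _)]
    gcongr
  have hsub : {ω | Z ω = 0 ∨ s < |Real.log (Z ω)|} ⊆
      {ω | ENNReal.ofReal (Real.exp (k * s)) ≤ ENNReal.ofReal (Z ω) ^ (k : ℝ)} ∪
      {ω | ENNReal.ofReal (Real.exp (k * s)) ≤ ENNReal.ofReal (Z ω) ^ (-(k : ℝ))} := by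
    intro ω hω
    rcases (hZ ω).eq_or_lt with h0 | h0
    · refine Or.inr ?_
      rw [Set.mem_ofPred_eq, ← h0, ENNReal.ofReal_zero, ENNReal.zero_rpow_of_neg (by linarith)]
      exact le_top
    · rcases lt_abs.1 (hω.resolve_left h0.ne') with h1 | h1
      · refine Or.inl ?_
        rw [Set.mem_ofPred_eq, ENNReal.ofReal_rpow_of_pos h0, Real.rpow_def_of_pos h0]
        exact ENNReal.ofReal_le_ofReal (Real.exp_le_exp.2 (by nlinarith))
      · refine Or.inr ?_
        rw [Set.mem_ofPred_eq, ENNReal.ofReal_rpow_of_pos h0, Real.rpow_def_of_pos h0]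
        exact ENNReal.ofReal_le_ofReal (Real.exp_le_exp.2 (by nlinarith))
  have h := (measure_mono hsub).trans ((measure_union_le _ _).trans (add_le_add
    (markov _ (by fun_prop) hpos) (markov _ (by fun_prop) hneg)))
  rw [← ENNReal.ofReal_add (by positivity) (by positivity), ← two_mul] at h
  exact ENNReal.toReal_le_of_le_ofReal (by positivity) h

section Deviation

variable {N : ℕ} {Ω : Type*} [MeasurableSpace Ω] {μ : Measure Ω} [IsProbabilityMeasure μ]
  {X : ℕ → Ω → Matrix (Fin N) (Fin N) ℝ}

/-- Moment bounds of order `±k` for a single factor, uniform in the unit vector, give a two-sided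
deviation bound for the product. -/
theorem measureReal_log_normApply_matProd_le (hm : ∀ i, Measurable (X i))
    (hind : iIndepFun X μ) {D : Matrix (Fin N) (Fin N) ℝ → ℝ} (hD : Measurable D)
    (hD0 : ∀ A, 0 ≤ D A) (hDpos : ∀ i, ∀ᵐ ω ∂μ, 0 < D (X i ω)) {k : ℕ} (hk : 1 ≤ k) {c : ℝ}
    (hc : 0 ≤ c)
    (hpos : ∀ i, ∀ u : EuclideanSpace ℝ (Fin N), ‖u‖ = 1 →
      ∫⁻ ω, ENNReal.ofReal (normApply (X i ω) u ^ 2 / D (X i ω)) ^ (k : ℝ) ∂μ ≤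
        ENNReal.ofReal (Real.exp c))
    (hneg : ∀ i, ∀ u : EuclideanSpace ℝ (Fin N), ‖u‖ = 1 →
      ∫⁻ ω, ENNReal.ofReal (normApply (X i ω) u ^ 2 / D (X i ω)) ^ (-(k : ℝ)) ∂μ ≤
        ENNReal.ofReal (Real.exp c))
    {v : EuclideanSpace ℝ (Fin N)} (hv : ‖v‖ = 1) {n : ℕ} (hn : 1 ≤ n) (t : ℝ) :
    μ.real {ω | t < |(1 / (n : ℝ)) * Real.log (normApply (matProd (fun i => X i ω) n) v ^ 2)
        - (1 / (n : ℝ)) * ∑ i ∈ Finset.range n, Real.log (D (X i ω))|} ≤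
      2 * Real.exp (n * (c - k * t)) := by
  have hn' : (0 : ℝ) < n := by exact_mod_cast hn
  have hC : 1 ≤ ENNReal.ofReal (Real.exp c) := by
    simpa using hc
  have hCn : ENNReal.ofReal (Real.exp c) ^ n = ENNReal.ofReal (Real.exp (n * c)) := by
    rw [← ENNReal.ofReal_pow (Real.exp_pos c).le, ← Real.exp_nat_mul]
  have h1 := lintegral_matProd_rpow_le hm hind hD hD0 hC hpos hv n
  have h2 := lintegral_matProd_rpow_le hm hind hD hD0 hC hneg hv n
  rw [hCn] at h1 h2
  have hZm : Measurable fun ω => normApply (matProd (fun i => X i ω) n) v ^ 2 /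
      ∏ i ∈ Finset.range n, D (X i ω) :=
    (((measurable_normApply_left v).comp (measurable_matProd hm n)).pow_const 2).div
      (Finset.measurable_prod _ fun i _ => hD.comp (hm i))
  have h3 := measureReal_lt_abs_log_le (s := n * t) hZm
    (fun ω => div_nonneg (sq_nonneg _) (Finset.prod_nonneg fun i _ => hD0 _)) hk h1 h2
  have he : (n : ℝ) * c - k * (n * t) = n * (c - k * t) := by ring
  rw [he] at h3
  refine le_trans ?_ h3
  refine ENNReal.toReal_mono (measure_ne_top _ _) (measure_mono_ae ?_)
  filter_upwards [ae_all_iff.2 hDpos] with ω hω hωt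
  have hωt : t < |_| := hωt
  have hprod : 0 < ∏ i ∈ Finset.range n, D (X i ω) := Finset.prod_pos fun i _ => hω i
  by_cases h0 : normApply (matProd (fun i => X i ω) n) v ^ 2 = 0
  · exact Or.inl (by rw [h0, zero_div])
  · refine Or.inr ?_
    rw [Real.log_div h0 hprod.ne', Real.log_prod fun i _ => (hω i).ne']
    rw [← mul_sub, abs_mul, abs_of_pos (by positivity), one_div, ← div_eq_inv_mul,
      lt_div_iff₀ hn'] at hωt
    linarith

/-! ### The choice of the moment -/

/-- The order `⌊N t / (4b)⌋` nearly minimizes the exponent `2 b k (k + 1) / N - k t`. -/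
theorem exponent_floor_le {N b t : ℝ} (hN : 0 < N) (hb : 0 < b) (ht : 0 < t) :
    2 * b * (⌊N * t / (4 * b)⌋₊ * (⌊N * t / (4 * b)⌋₊ + 1)) / N - ⌊N * t / (4 * b)⌋₊ * t ≤
      t - N * t ^ 2 / (8 * b) := by
  have hx : 0 < N * t / (4 * b) := by positivity
  have h1 := Nat.floor_le hx.le
  have h2 := Nat.lt_floor_add_one (N * t / (4 * b))
  set x := N * t / (4 * b) with hxdef
  set k : ℝ := (⌊x⌋₊ : ℝ)
  have hk : 0 ≤ k := Nat.cast_nonneg _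
  have e1 : 2 * b * (k * (k + 1)) / N = t / 2 * (k / x * (k + 1)) := by
    rw [hxdef]; field_simp; ring
  have e2 : N * t ^ 2 / (8 * b) = t / 2 * x := by rw [hxdef]; field_simp; ring
  have h3 : k / x * (k + 1) ≤ k + 1 := by
    have : k / x ≤ 1 := (div_le_one hx).2 h1
    nlinarith
  rw [e1, e2]
  nlinarith [mul_le_mul_of_nonneg_left h3 (half_pos ht).le]

theorem GaussianSeq.measureReal_le {σ : ℝ} (hσ : 0 < σ) (hX : GaussianSeq μ σ X) {t : ℝ}
    (ht : 0 < t) (ht1 : t < 1 / 2) (hN : 6 / t ≤ N) {v : EuclideanSpace ℝ (Fin N)} (hv : ‖v‖ = 1)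
    {n : ℕ} (hn : 1 ≤ n) :
    μ.real {ω | t < |(1 / (n : ℝ)) * Real.log (normApply (matProd (fun i => X i ω) n) v)
        - Real.log σ|} ≤ 2 * Real.exp (-((1 / 8) * N * n * t ^ 2)) := by
  rw [div_le_iff₀ ht] at hN
  have hN0 : (0 : ℝ) < N := by
    by_contra hc
    nlinarith
  have hN1 : 1 ≤ N := by exact_mod_cast hN0
  have hn' : (0 : ℝ) < n := by exact_mod_cast hn
  set k := ⌊(N : ℝ) * (2 * t) / (4 * 1)⌋₊ with hkdef
  have hk1 : 1 ≤ k := by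
    rw [hkdef, Nat.one_le_floor_iff, le_div_iff₀ (by norm_num)]
    linarith
  have hkN : 4 * 1 * (k : ℝ) ≤ N := by
    have := Nat.floor_le (show 0 ≤ (N : ℝ) * (2 * t) / (4 * 1) by positivity)
    rw [← hkdef, le_div_iff₀ (by norm_num)] at this
    nlinarith
  have h := measureReal_log_normApply_matProd_le hX.measurable hX.indep (D := fun _ => σ ^ 2)
    measurable_const (fun _ => sq_nonneg σ) (fun _ => ae_of_all _ fun _ => by positivity)
    hk1 (c := 2 * 1 * (k * (k + 1)) / N) (by positivity)
    (fun i u hu => lintegral_rpow_le_of_gaussian hN1 hσ (hX.measurable i) (hX.indep_entries i)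
      (hX.law i) hu hkN)
    (fun i u hu => lintegral_rpow_neg_le_of_gaussian hN1 hσ (hX.measurable i) (hX.indep_entries i)
      (hX.law i) hu hk1 hkN) hv hn (2 * t)
  refine (measureReal_mono fun ω (hω : t < |_|) => ?_).trans (h.trans ?_)
  · rw [Set.mem_ofPred_eq]
    have e : (1 / (n : ℝ)) * Real.log (normApply (matProd (fun i => X i ω) n) v ^ 2) -
        (1 / (n : ℝ)) * ∑ i ∈ Finset.range n, Real.log (σ ^ 2) =
        2 * ((1 / (n : ℝ)) * Real.log (normApply (matProd (fun i => X i ω) n) v) - Real.log σ) := by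
      simp only [Real.log_pow, Finset.sum_const, Finset.card_range, nsmul_eq_mul]
      field_simp
      push_cast
      ring
    rw [e, abs_mul, abs_two]
    linarith
  · have h2 := exponent_floor_le hN0 one_pos (show 0 < 2 * t by positivity)
    rw [← hkdef] at h2
    have h3 : 2 * t - N * (2 * t) ^ 2 / (8 * 1) ≤ -((1 / 8) * N * t ^ 2) := by nlinarith
    have h4 := mul_le_mul_of_nonneg_left (h2.trans h3) hn'.le
    have h5 : (n : ℝ) * -((1 / 8) * N * t ^ 2) = -((1 / 8) * N * n * t ^ 2) := by ring
    rw [h5] at h4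
    gcongr

/-- The largest squared singular value is at least the mean. -/
theorem one_le_of_sqSing_le (hN : 1 ≤ N) {A : Matrix (Fin N) (Fin N) ℝ} (hA : A ≠ 0) {b : ℝ}
    (hb : ∀ i, sqSing A i ≤ b * sbar A) : 1 ≤ b := by
  have hN' : (0 : ℝ) < N := by exact_mod_cast hN
  have hs := sbar_pos hN hA
  have h := Finset.sum_le_sum fun i (_ : i ∈ Finset.univ) => hb i
  rw [sum_sqSing hN] at h
  simp only [Finset.sum_const, Finset.card_univ, Fintype.card_fin, nsmul_eq_mul] at h
  have h2 := le_of_mul_le_mul_left h hN'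
  nlinarith

theorem BoundedRotInvSeq.measureReal_le {b : ℝ} (hb : 0 < b) (hX : BoundedRotInvSeq μ b X) {t : ℝ}
    (ht : 0 < t) (ht1 : t < 1 / 4) (hN : 11 * b / t ≤ N) {v : EuclideanSpace ℝ (Fin N)}
    (hv : ‖v‖ = 1) {n : ℕ} (hn : 1 ≤ n) :
    μ.real {ω | t < |(1 / (n : ℝ)) * Real.log (normApply (matProd (fun i => X i ω) n) v ^ 2)
        - (1 / (n : ℝ)) * ∑ i ∈ Finset.range n, Real.log (sbar (X i ω))|} ≤
      2 * Real.exp (-((1 / (32 * b ^ 2)) * N * n * t ^ 2)) := by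
  rw [div_le_iff₀ ht] at hN
  have hN0 : (0 : ℝ) < N := by
    by_contra hc
    nlinarith
  have hN1 : 1 ≤ N := by exact_mod_cast hN0
  have hn' : (0 : ℝ) < n := by exact_mod_cast hn
  have hb1 : 1 ≤ b := by
    obtain ⟨ω, hω1, hω2⟩ := ((hX.bounded 0).and (hX.ne_zero 0)).exists
    exact one_le_of_sqSing_le hN1 hω2 hω1
  set k := ⌊(N : ℝ) * t / (4 * b)⌋₊ with hkdef
  have hk1 : 1 ≤ k := by
    rw [hkdef, Nat.one_le_floor_iff, le_div_iff₀ (by positivity)]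
    linarith
  have hkN : 4 * b * (k : ℝ) ≤ N := by
    have := Nat.floor_le (show 0 ≤ (N : ℝ) * t / (4 * b) by positivity)
    rw [← hkdef, le_div_iff₀ (by positivity)] at this
    nlinarith
  have h := measureReal_log_normApply_matProd_le hX.measurable hX.indep measurable_sbar sbar_nonneg
    (fun i => (hX.ne_zero i).mono fun ω hω => sbar_pos hN1 hω)
    hk1 (c := 2 * b * (k * (k + 1)) / N) (by positivity)
    (fun i u hu => (hX.rotInvariant i).lintegral_rpow_le hN1 (hX.measurable i) hb (hX.bounded i)
      (hX.ne_zero i) hu hkN)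
    (fun i u hu => (hX.rotInvariant i).lintegral_rpow_neg_le hN1 (hX.measurable i) hb (hX.bounded i)
      (hX.ne_zero i) hu hk1 hkN) hv hn t
  refine h.trans ?_
  have h2 := exponent_floor_le hN0 hb ht
  rw [← hkdef] at h2
  have h3 : t - N * t ^ 2 / (8 * b) ≤ -((1 / (32 * b ^ 2)) * N * t ^ 2) := by
    have e : -((1 / (32 * b ^ 2)) * N * t ^ 2) - (t - N * t ^ 2 / (8 * b)) =
        t * (4 * b * (N * t) - N * t - 32 * b ^ 2) / (32 * b ^ 2) := by
      field_simp
      ring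
    have : 0 ≤ 4 * b * (N * t) - N * t - 32 * b ^ 2 := by nlinarith
    have : 0 ≤ t * (4 * b * (N * t) - N * t - 32 * b ^ 2) / (32 * b ^ 2) := by positivity
    linarith
  have h4 := mul_le_mul_of_nonneg_left (h2.trans h3) hn'.le
  have h5 : (n : ℝ) * -((1 / (32 * b ^ 2)) * N * t ^ 2) =
      -((1 / (32 * b ^ 2)) * N * n * t ^ 2) := by ring
  rw [h5] at h4
  gcongr

end Deviation

end RandomProduct

theorem proposition1 :
    (∃ t₀ : ℝ, 0 < t₀ ∧ ∀ t : ℝ, 0 < t → t < t₀ → ∃ N₁ : ℕ, ∀ N : ℕ, N₁ ≤ N →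
      ∀ (Ω : Type*) [MeasurableSpace Ω] (μ : Measure Ω) [IsProbabilityMeasure μ]
        (σ : ℝ) (_ : 0 < σ) (X : ℕ → Ω → Matrix (Fin N) (Fin N) ℝ)
        (_ : RandomProduct.GaussianSeq μ σ X)
        (v : EuclideanSpace ℝ (Fin N)) (_ : ‖v‖ = 1) (n : ℕ) (_ : 1 ≤ n),
        μ.real {ω | t < |(1 / (n : ℝ)) *
              Real.log (RandomProduct.normApply (RandomProduct.matProd (fun i => X i ω) n) v)
            - Real.log σ|}
          ≤ 2 * Real.exp (-((1 / 8) * N * n * t ^ 2))) ∧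
    (∀ b : ℝ, 0 < b → ∀ t : ℝ, 0 < t → t < 1 / 4 → ∃ N₁ : ℕ, ∀ N : ℕ, N₁ ≤ N →
      ∀ (Ω : Type*) [MeasurableSpace Ω] (μ : Measure Ω) [IsProbabilityMeasure μ]
        (X : ℕ → Ω → Matrix (Fin N) (Fin N) ℝ)
        (_ : RandomProduct.BoundedRotInvSeq μ b X)
        (v : EuclideanSpace ℝ (Fin N)) (_ : ‖v‖ = 1) (n : ℕ) (_ : 1 ≤ n),
        μ.real {ω | t < |(1 / (n : ℝ)) *
              Real.log (RandomProduct.normApply (RandomProduct.matProd (fun i => X i ω) n) v ^ 2)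
            - (1 / (n : ℝ)) * ∑ i ∈ Finset.range n, Real.log (RandomProduct.sbar (X i ω))|}
          ≤ 2 * Real.exp (-((1 / (32 * b ^ 2)) * N * n * t ^ 2))) := by
  -- `N t ≥ 6`, or `N t ≥ 11 b`, makes `k ≥ 1` and absorbs the `O(t)` error from rounding `k` into the
  -- slack between the optimal exponent and the stated one.
  refine ⟨⟨1 / 2, by norm_num, fun t ht ht1 => ⟨⌈6 / t⌉₊, ?_⟩⟩,
    fun b hb t ht ht1 => ⟨⌈11 * b / t⌉₊, ?_⟩⟩
  · intro N hN Ω _ μ _ σ hσ X hX v hv n hn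
    exact hX.measureReal_le hσ ht ht1 (Nat.ceil_le.1 hN) hv hn
  · intro N hN Ω _ μ _ X hX v hv n hn
    exact hX.measureReal_le hb ht ht1 (Nat.ceil_le.1 hN) hv hn
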